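/- **Setting.** In the one-dimensional coagulation-diffusion process each site of an infinite chain $\mathbb{Z}$ with lattice constant $a>0$ is either empty or occupied by one particle. Each particle hops to each of its two neighbouring sites at rate $\Gamma=D/a^2$, where $D>0$ is fixed; if the target site is already occupied, one of the two particles disappears. The law of the configuration at time $t$ is given by the master equation of this dynamics. The initial state is an arbitrary translation-invariant random configuration. Let $E_n(t)$ be the probability that $n$ consecutive sites are empty at time $t$, and $E_{n_1,n_2}(d,t)$ the probability that two intervals of $n_1$ and $n_2$ consecutive sites, separated by $d$ sites, are both empty at time $t$. Consider a sequence of lattice constants $a\to 0$ and initial states such that the continuum limits $$E_0(x)=\lim_{a\to0}E_{\lfloor x/a\rfloor}(0),\qquad E_0(x,y,z)=\lim_{a\to0}E_{\lfloor x/a\rfloor,\lfloor y/a\rfloor}(\lfloor z/a\rfloor,0)$$ exist for all $x,y,z>0$. Put $\ell_0=\sqrt{8Dt}$ and $\operatorname{erfc}(x)=\frac{2}{\sqrt\pi}\int_x^\infty e^{-s^2}\,ds$. **Statement.** For all $t>0$ and $x,y,z\ge 0$ the continuum limit $E(x,y,z,t)=\lim_{a\to0}E_{\lfloor x/a\rfloor,\lfloor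 y/a\rfloor}(\lfloor z/a\rfloor,t)$ exists and $$E(x,y,z,t)=E^{(0)}(x,y,z,t)+E^{(1)}(x,y,z,t)+E^{(2)}(x,y,z,t),$$ where $$E^{(0)}=\operatorname{erfc}\!\left(\tfrac{x}{\ell_0}\right)\operatorname{erfc}\!\left(\tfrac{y}{\ell_0}\right)+\operatorname{erfc}\!\left(\tfrac{z}{\ell_0}\right)\operatorname{erfc}\!\left(\tfrac{x+y+z}{\ell_0}\right)-\operatorname{erfc}\!\left(\tfrac{x+z}{\ell_0}\right)\operatorname{erfc}\!\left(\tfrac{y+z}{\ell_0}\right),$$ $$E^{(1)}=\int_0^\infty\frac{dx'}{\ell_0\sqrt\pi}\,E_0(x')\,K_1\!\left(\tfrac{x'}{\ell_0};\tfrac{x}{\ell_0},\tfrac{y}{\ell_0},\tfrac{z}{\ell_0}\right),$$ $$E^{(2)}=\frac{\sqrt2}{\ell_0^3\pi^{3/2}}\int_{\mathbb{R}_+^3}dx'\,dy'\,dz'\,E_0(x',y',z')\,\mathcal W\!\left(\tfrac{x-x'}{\ell_0},\tfrac{y-y'}{\ell_0},\tfrac{z-z'}{\ell_0}\right)K_2\!\left(\tfrac{x'}{\ell_0},\tfrac{y'}{\ell_0},\tfrac{z'}{\ell_0};\tfrac{x}{\ell_0},\tfrac{y}{\ell_0},\tfrac{z}{\ell_0}\right),$$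 both integrals converging absolutely, with $\mathcal W(u,v,w)=\exp\!\left[-(u+v+w)^2-w^2-\tfrac12(u-v)^2\right]$, $$\begin{aligned}K_1(x';x,y,z)={}&\operatorname{erfc}(z)\left[e^{-(x'-x-y-z)^2}-e^{-(x'+x+y+z)^2}\right]+\operatorname{erfc}(x)\left[e^{-(x'-y)^2}-e^{-(x'+y)^2}\right]\\&-\operatorname{erfc}(x+z)\left[e^{-(x'-y-z)^2}-e^{-(x'+y+z)^2}\right]+\operatorname{erfc}(y)\left[e^{-(x'-x)^2}-e^{-(x'+x)^2}\right]\\&-\operatorname{erfc}(y+z)\left[e^{-(x'-x-z)^2}-e^{-(x'+x+z)^2}\right]+\operatorname{erfc}(x+y+z)\left[e^{-(x'-z)^2}-e^{-(x'+z)^2}\right],\end{aligned}$$ $$\begin{aligned}K_2(x',y',z';x,y,z)={}&\left[1-e^{-4(x'+y'+z')(x+y+z)}\right]\left[1-e^{-4z'z}\right]\\&+e^{-4x'x-4y'y}\left[1-e^{-4z'(x+y+z)}\right]\left[1-e^{-4(x'+y'+z')z}\right]\\&-e^{-4x'x}\left[1-e^{-4(y'+z')(x+y+z)}\right]\left[1-e^{-4(x'+z')z}\right]\\&-e^{-4y'y}\left[1-e^{-4(x'+z')(x+y+z)}\right]\left[1-e^{-4(y'+z')z}\right]\\&+e^{-4x'x-4z'(x+z)}\left[1-e^{-4y'(x+y+z)}\right]\left[1-e^{-4x'z}\right]\\&+e^{-4y'y-4z'(y+z)}\left[1-e^{-4x'(x+y+z)}\right]\left[1-e^{-4y'z}\right].\end{aligned}$$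 In particular, if the lattice is initially entirely filled with particles, then $E(x,y,z,t)=E^{(0)}(x,y,z,t)$ for all $t>0$ and $x,y,z\ge0$. -/

import Mathlib

open MeasureTheory Set Filter Topology

noncomputable section

namespace CoagulationDiffusion

/-! ### The coagulation-diffusion process on the chain `ℤ` -/

/-- A configuration of the infinite chain: `η i = true` iff site `i` carries a particle. -/
abbrev Config : Type := ℤ → Bool

/-- The configuration after the particle at site `i` has hopped to site `j`. If `j` was empty the
particle is placed there (`A + ∅ → ∅ + A`); if `j` was occupied, one of the two particles
disappears (`A + A → A`). In both cases `i` is empty and `j` is occupied afterwards. -/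
def hop (η : Config) (i j : ℤ) : Config :=
  Function.update (Function.update η i false) j true

/-- The generator of the process, acting on observables that depend on finitely many sites: each
particle hops to each of its two neighbouring sites at rate `Γ`. For such observables only
finitely many summands are nonzero. -/
def generator (Γ : ℝ) (f : Config → ℝ) (η : Config) : ℝ :=
  Γ * ∑ᶠ i : ℤ,
    if η i = true then (f (hop η i (i + 1)) - f η) + (f (hop η i (i - 1)) - f η) else 0

/-- `μ t`, `t ≥ 0`, is the law at time `t` of the coagulation-diffusion process with hopping
rate `Γ` started from the law `μ 0`: it solves the master equation (Kolmogorov's forward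
equation), tested against all observables that depend on finitely many sites. -/
structure IsLaw (Γ : ℝ) (μ : ℝ → Measure Config) : Prop where
  isProbabilityMeasure : ∀ t, 0 ≤ t → IsProbabilityMeasure (μ t)
  master : ∀ (f : Config → ℝ) (S : Finset ℤ), DependsOn f (S : Set ℤ) → ∀ t, 0 ≤ t →
    HasDerivWithinAt (fun s => ∫ η, f η ∂(μ s)) (∫ η, generator Γ f η ∂(μ t)) (Ici 0) t

/-- Spatial homogeneity: invariance under the translation of the chain by one site. -/
def IsTranslationInvariant (ν : Measure Config) : Prop :=
  ν.map (fun (η : Config) (i : ℤ) => η (i + 1)) = ν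

/-- The probability that all sites in `S` are empty. -/
def emptyProb (ν : Measure Config) (S : Finset ℤ) : ℝ :=
  ν.real {η | ∀ i ∈ S, η i = false}

/-- `E_n`: the probability that `n` consecutive sites are empty. -/
def oneInterval (ν : Measure Config) (n : ℕ) : ℝ :=
  emptyProb ν (Finset.Ico 0 (n : ℤ))

/-- `E_{n₁,n₂}(d)`: the probability that two intervals of `n₁` and `n₂` consecutive sites,
separated by `d` sites, are both empty. -/
def twoInterval (ν : Measure Config) (n₁ n₂ d : ℕ) : ℝ :=
  emptyProb ν (Finset.Ico 0 (n₁ : ℤ) ∪ Finset.Ico ((n₁ : ℤ) + d) ((n₁ : ℤ) + d + n₂))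

/-! ### The continuum expressions -/

/-- The complementary error function. -/
def erfc (x : ℝ) : ℝ := 2 / √Real.pi * ∫ s in Ioi x, Real.exp (-s ^ 2)

/-- The diffusion length `ℓ₀ = √(8 D t)`. -/
def diffLength (D t : ℝ) : ℝ := √(8 * D * t)

/-- The Gaussian kernel `𝒲`, in lengths measured in units of `ℓ₀`. -/
def gaussKernel (u v w : ℝ) : ℝ :=
  Real.exp (-(u + v + w) ^ 2 - w ^ 2 - 1 / 2 * (u - v) ^ 2)

/-- The kernel `K₁(x'; x, y, z)`, in lengths measured in units of `ℓ₀`. -/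
def K₁ (x' x y z : ℝ) : ℝ :=
  erfc z * (Real.exp (-(x' - x - y - z) ^ 2) - Real.exp (-(x' + x + y + z) ^ 2))
  + erfc x * (Real.exp (-(x' - y) ^ 2) - Real.exp (-(x' + y) ^ 2))
  - erfc (x + z) * (Real.exp (-(x' - y - z) ^ 2) - Real.exp (-(x' + y + z) ^ 2))
  + erfc y * (Real.exp (-(x' - x) ^ 2) - Real.exp (-(x' + x) ^ 2))
  - erfc (y + z) * (Real.exp (-(x' - x - z) ^ 2) - Real.exp (-(x' + x + z) ^ 2))
  + erfc (x + y + z) * (Real.exp (-(x' - z) ^ 2) - Real.exp (-(x' + z) ^ 2))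

/-- The kernel `K₂(x', y', z'; x, y, z)`, in lengths measured in units of `ℓ₀`. -/
def K₂ (x' y' z' x y z : ℝ) : ℝ :=
  (1 - Real.exp (-4 * (x' + y' + z') * (x + y + z))) * (1 - Real.exp (-4 * z' * z))
  + Real.exp (-4 * x' * x - 4 * y' * y) *
      (1 - Real.exp (-4 * z' * (x + y + z))) * (1 - Real.exp (-4 * (x' + y' + z') * z))
  - Real.exp (-4 * x' * x) *
      (1 - Real.exp (-4 * (y' + z') * (x + y + z))) * (1 - Real.exp (-4 * (x' + z') * z))
  - Real.exp (-4 * y' * y) *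
      (1 - Real.exp (-4 * (x' + z') * (x + y + z))) * (1 - Real.exp (-4 * (y' + z') * z))
  + Real.exp (-4 * x' * x - 4 * z' * (x + z)) *
      (1 - Real.exp (-4 * y' * (x + y + z))) * (1 - Real.exp (-4 * x' * z))
  + Real.exp (-4 * y' * y - 4 * z' * (y + z)) *
      (1 - Real.exp (-4 * x' * (x + y + z))) * (1 - Real.exp (-4 * y' * z))

/-- The contribution `E⁽⁰⁾`, as a function of the diffusion length `ℓ` and of `x, y, z`. -/
def Ezero (l x y z : ℝ) : ℝ :=
  erfc (x / l) * erfc (y / l) + erfc (z / l) * erfc ((x + y + z) / l)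
    - erfc ((x + z) / l) * erfc ((y + z) / l)

/-- The integrand of `E⁽¹⁾`; `E₀ x'` is the initial one-interval probability. -/
def EoneIntegrand (E₀ : ℝ → ℝ) (l x y z : ℝ) (x' : ℝ) : ℝ :=
  E₀ x' * K₁ (x' / l) (x / l) (y / l) (z / l)

/-- The contribution `E⁽¹⁾` of the initial one-interval probability. -/
def Eone (E₀ : ℝ → ℝ) (l x y z : ℝ) : ℝ :=
  1 / (l * √Real.pi) * ∫ x' in Ioi (0 : ℝ), EoneIntegrand E₀ l x y z x'

/-- The integrand of `E⁽²⁾`, as a function of `p = (x', y', z')`; `F₀ x' y' z'` is the initial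
two-interval probability. -/
def EtwoIntegrand (F₀ : ℝ → ℝ → ℝ → ℝ) (l x y z : ℝ) (p : ℝ × ℝ × ℝ) : ℝ :=
  F₀ p.1 p.2.1 p.2.2
    * gaussKernel ((x - p.1) / l) ((y - p.2.1) / l) ((z - p.2.2) / l)
    * K₂ (p.1 / l) (p.2.1 / l) (p.2.2 / l) (x / l) (y / l) (z / l)

/-- The contribution `E⁽²⁾` of the initial two-interval probability. -/
def Etwo (F₀ : ℝ → ℝ → ℝ → ℝ) (l x y z : ℝ) : ℝ :=
  √2 / (l ^ 3 * √Real.pi ^ 3) *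
    ∫ p in Ioi (0 : ℝ) ×ˢ Ioi (0 : ℝ) ×ˢ Ioi (0 : ℝ), EtwoIntegrand F₀ l x y z p

end CoagulationDiffusion

end

/-! The event that a finite set of sites is empty evolves in closed form. Only hops across a bond
between a site of the set and a site outside it matter. For such a hop the occupation factor
disappears and the hop amounts to shifting an endpoint by one (`emptyInd_hop`,
`generator_emptyInd`). The empty probabilities of one or two intervals therefore solve the lattice
heat equation in their two or four endpoints, as long as these are strictly ordered. When
neighbouring endpoints meet, an interval disappears or the two intervals merge, so the boundary
values are 1 or a one-interval probability.

This boundary value problem has an explicit solution (`IsLaw.emptyProb_blocks`). The one-interval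
probability is `p + h`, a function of the length. Here `p` equals 1 at length 0 and starts from 0 at
positive lengths, while `h` is odd and carries the initial data. The Pfaffian of `a (x j - x i)`
solves the heat equation on `ℤ⁴` if `a` solves it at twice the rate. If `a 0 = 1` it reduces to the
right one-interval value when neighbouring endpoints coincide. In the Pfaffian of `p + h` the part
quadratic in `h` vanishes on the walls and is dropped. The rest vanishes initially inside the
chamber, since each term has a factor `p`. The initial two-interval probabilities enter through an
alternating sum `V` over permutations, which vanishes on the walls. Uniqueness comes from the
comparison principle `nonneg_of_deriv_ge`.

For the continuum limit, solutions are written as averages of their initial values against the walk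
kernel. The local limit theorem `tendsto_walkKernel` gives pointwise convergence to the Gaussian.
All masses are one, so Scheffé's lemma upgrades this to convergence in `L¹`, which suffices for
initial profiles that are merely bounded and pointwise convergent. The `p p`, `p h + h p` and `V`
parts become `E⁽⁰⁾`, `E⁽¹⁾` and `E⁽²⁾`. In the last one the initial data depend only on lengths and
gap, so the position of the pair is integrated out. The remaining 4×4 determinant of exponentials is
`𝒲` times `K₂` (`integral_chamberDensity`). -/

noncomputable section

namespace CoagulationDiffusion

/-! ### Comparison and lattice heat equations -/

/-- A family of functions of time that is bounded uniformly on compact time intervals. -/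
def LocBdd {I : Type*} (u : I → ℝ → ℝ) : Prop :=
  ∀ T, ∃ B, ∀ x t, 0 ≤ t → t ≤ T → |u x t| ≤ B

/-- The heat equation on `I` with jump maps `ν j` of rate `c`. -/
def IsHeatSol {I J : Type*} [Fintype J] (c : ℝ) (ν : J → I → I) (u : I → ℝ → ℝ) : Prop :=
  ∀ x t, 0 ≤ t → HasDerivWithinAt (u x) (c * ∑ j, (u (ν j x) t - u x t)) (Ici 0) t

/-! ### Calculus of locally bounded families -/

section LocBdd
variable {I I' : Type*} {u v : I → ℝ → ℝ}

lemma LocBdd.of_le {B : ℝ} (h : ∀ x t, 0 ≤ t → |u x t| ≤ B) : LocBdd u :=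
  fun _ => ⟨B, fun x t ht _ => h x t ht⟩

lemma LocBdd.add (hu : LocBdd u) (hv : LocBdd v) : LocBdd fun x t => u x t + v x t := by
  intro T
  obtain ⟨B, hB⟩ := hu T
  obtain ⟨C, hC⟩ := hv T
  exact ⟨B + C, fun x t h0 hT => (abs_add_le _ _).trans (add_le_add (hB x t h0 hT) (hC x t h0 hT))⟩

lemma LocBdd.neg (hu : LocBdd u) : LocBdd fun x t => -u x t := by
  intro T
  obtain ⟨B, hB⟩ := hu T
  exact ⟨B, fun x t h0 hT => by simpa using hB x t h0 hT⟩

lemma LocBdd.sub (hu : LocBdd u) (hv : LocBdd v) : LocBdd fun x t => u x t - v x t := by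
  simpa only [sub_eq_add_neg] using hu.add hv.neg

lemma LocBdd.mul (hu : LocBdd u) (hv : LocBdd v) : LocBdd fun x t => u x t * v x t := by
  intro T
  obtain ⟨B, hB⟩ := hu T
  obtain ⟨C, hC⟩ := hv T
  refine ⟨B * C, fun x t h0 hT => ?_⟩
  rw [abs_mul]
  exact mul_le_mul (hB x t h0 hT) (hC x t h0 hT) (abs_nonneg _)
    ((abs_nonneg _).trans (hB x t h0 hT))

lemma LocBdd.comp (hu : LocBdd u) (g : I' → I) : LocBdd fun x t => u (g x) t := by
  intro T
  obtain ⟨B, hB⟩ := hu T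
  exact ⟨B, fun x t h0 hT => hB (g x) t h0 hT⟩

lemma LocBdd.sum {ι : Type*} (s : Finset ι) {w : ι → I → ℝ → ℝ} (h : ∀ i ∈ s, LocBdd (w i)) :
    LocBdd fun x t => ∑ i ∈ s, w i x t := by
  classical
  induction s using Finset.induction_on with
  | empty => exact .of_le (B := 0) (by simp)
  | insert a s ha ih =>
    simp only [Finset.sum_insert ha]
    exact (h a (by simp)).add (ih fun i hi => h i (by simp [hi]))

lemma LocBdd.ite (hu : LocBdd u) (p : I → Prop) [DecidablePred p] :
    LocBdd fun x t => if p x then u x t else 0 := by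
  intro T
  obtain ⟨B, hB⟩ := hu T
  refine ⟨B, fun x t h0 hT => ?_⟩
  have := hB x t h0 hT
  dsimp only
  split_ifs
  · exact this
  · simpa using (abs_nonneg _).trans this

end LocBdd

/-- Comparison principle for locally bounded families. -/
lemma nonneg_of_deriv_ge {I : Type*} {w w' : I → ℝ → ℝ} {K : ℝ} (hK : 0 ≤ K) (hw : LocBdd w)
    (hd : ∀ i t, 0 ≤ t → HasDerivWithinAt (w i) (w' i t) (Ici 0) t) (h0 : ∀ i, 0 ≤ w i 0)
    (hc : ∀ t M, 0 ≤ t → 0 ≤ M → (∀ j, -M ≤ w j t) → ∀ i, -(K * M) ≤ w' i t + K * w i t)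
    (i : I) {t : ℝ} (ht : 0 ≤ t) : 0 ≤ w i t := by
  obtain ⟨B, hB⟩ := hw t
  have hB0 : 0 ≤ B := (abs_nonneg _).trans (hB i t ht le_rfl)
  set B' := B * Real.exp (K * t) with hB'
  have hB'0 : 0 ≤ B' := by positivity
  -- On an infinite index set the infimum need not be attained, so a minimum argument is replaced by
  -- Picard iteration. Each integration of the differential inequality for `exp (K s) * w` improves
  -- the bound on its negative part by one order, and `n → ∞` leaves zero.
  have key : ∀ n : ℕ, ∀ s, 0 ≤ s → s ≤ t → ∀ j,
      -(Real.exp (K * s) * w j s) ≤ B' * ((K * s) ^ n / n.factorial) := by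
    intro n
    induction n with
    | zero =>
      intro s hs hst j
      have h1 := neg_le_of_abs_le (hB j s hs hst)
      have h2 : Real.exp (K * s) ≤ Real.exp (K * t) := by gcongr
      have h3 := Real.exp_pos (K * s)
      simp only [pow_zero, Nat.factorial_zero, Nat.cast_one, div_one, mul_one, hB']
      nlinarith
    | succ n ih =>
      intro s hs hst j
      have hder : ∀ r, 0 ≤ r → HasDerivWithinAt (fun r => -(Real.exp (K * r) * w j r))
          (-(Real.exp (K * r) * (w' j r + K * w j r))) (Ici 0) r := by
        intro r hr
        have h1 : HasDerivAt (fun r => Real.exp (K * r)) (Real.exp (K * r) * K) r := by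
          simpa using ((hasDerivAt_id r).const_mul K).exp
        exact (h1.hasDerivWithinAt.mul (hd j r hr)).neg.congr_deriv (by ring)
      have hBd : ∀ r, HasDerivAt (fun r => B' * ((K * r) ^ (n + 1) / (n + 1).factorial))
          (B' * (K * ((K * r) ^ n / n.factorial))) r := by
        intro r
        have h1 : HasDerivAt (fun r => (K * r) ^ (n + 1)) (((n + 1 : ℕ) : ℝ) * (K * r) ^ n * K) r := by
          exact (((hasDerivAt_id r).const_mul K).pow (n + 1)).congr_deriv (by simp)
        refine ((h1.div_const ((n + 1).factorial : ℝ)).const_mul B').congr_deriv ?_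
        rw [Nat.factorial_succ]
        push_cast
        have : (n.factorial : ℝ) ≠ 0 := by positivity
        field_simp
      refine image_le_of_deriv_right_le_deriv_boundary (a := 0) (b := s)
        (f' := fun r => -(Real.exp (K * r) * (w' j r + K * w j r)))
        (B' := fun r => B' * (K * ((K * r) ^ n / n.factorial)))
        (fun r hr => ((hder r hr.1).continuousWithinAt).mono Icc_subset_Ici_self)
        (fun r hr => (hder r hr.1).mono (Ici_subset_Ici.2 hr.1)) ?_
        (fun r _ => (hBd r).continuousAt.continuousWithinAt)
        (fun r _ => (hBd r).hasDerivWithinAt) ?_ ⟨hs, le_rfl⟩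
      · simpa using h0 j
      · intro r hr
        have hr' : r ≤ t := hr.2.le.trans hst
        have he := Real.exp_pos (K * r)
        -- The induction hypothesis, with the factor `exp (K r)` divided out, is the uniform lower
        -- bound `-M` at time `r`.
        have hM := hc r (Real.exp (-(K * r)) * (B' * ((K * r) ^ n / n.factorial))) hr.1
          (by have := hr.1; positivity) (fun l => by
            have := ih r hr.1 hr' l
            rw [Real.exp_neg, neg_le, ← div_eq_inv_mul, le_div_iff₀ he]
            linarith) j
        have h5 : Real.exp (K * r) * Real.exp (-(K * r)) = 1 := by rw [← Real.exp_add]; simp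
        have := mul_le_mul_of_nonneg_left hM he.le
        have h6 : Real.exp (K * r) * -(K * (Real.exp (-(K * r)) * (B' * ((K * r) ^ n / n.factorial))))
            = -(B' * (K * ((K * r) ^ n / n.factorial))) := by
          linear_combination (-(K * (B' * ((K * r) ^ n / n.factorial)))) * h5
        linarith
  have hlim : Tendsto (fun n : ℕ => B' * ((K * t) ^ n / n.factorial)) atTop (𝓝 0) := by
    simpa using (FloorSemiring.tendsto_pow_div_factorial_atTop (K * t)).const_mul B'
  have := ge_of_tendsto' hlim fun n => key n t ht le_rfl i
  have he := Real.exp_pos (K * t)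
  by_contra! hneg
  nlinarith

/-! ### Heat equations with finitely many jump maps: linearity, positivity, uniqueness, existence -/

section Heat
variable {I J : Type*} [Fintype J] {c : ℝ} {ν : J → I → I} {u v : I → ℝ → ℝ}

lemma IsHeatSol.add (hu : IsHeatSol c ν u) (hv : IsHeatSol c ν v) :
    IsHeatSol c ν fun x t => u x t + v x t := by
  intro x t ht
  refine ((hu x t ht).add (hv x t ht)).congr_deriv ?_
  rw [← mul_add, ← Finset.sum_add_distrib]
  congr 1
  exact Finset.sum_congr rfl fun _ _ => by ring

lemma IsHeatSol.const_mul (hu : IsHeatSol c ν u) (b : ℝ) :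
    IsHeatSol c ν fun x t => b * u x t := by
  intro x t ht
  refine ((hu x t ht).const_mul b).congr_deriv ?_
  rw [mul_left_comm, Finset.mul_sum]
  congr 1
  exact Finset.sum_congr rfl fun _ _ => by ring

lemma IsHeatSol.neg (hu : IsHeatSol c ν u) : IsHeatSol c ν fun x t => -u x t := by
  simpa using hu.const_mul (-1)

lemma IsHeatSol.sub (hu : IsHeatSol c ν u) (hv : IsHeatSol c ν v) :
    IsHeatSol c ν fun x t => u x t - v x t := by
  simpa only [sub_eq_add_neg] using hu.add hv.neg

lemma isHeatSol_const (b : ℝ) : IsHeatSol c ν fun _ _ => b := by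
  intro x t _
  simpa using hasDerivWithinAt_const t (Ici (0 : ℝ)) b

lemma IsHeatSol.sum {ι : Type*} (s : Finset ι) {w : ι → I → ℝ → ℝ}
    (h : ∀ i ∈ s, IsHeatSol c ν (w i)) : IsHeatSol c ν fun x t => ∑ i ∈ s, w i x t := by
  classical
  induction s using Finset.induction_on with
  | empty => simpa using isHeatSol_const (c := c) (ν := ν) 0
  | insert a s ha ih =>
    simp only [Finset.sum_insert ha]
    exact (h a (by simp)).add (ih fun i hi => h i (by simp [hi]))

/-- Reparametrising the lattice by a map that permutes the jumps. -/
lemma IsHeatSol.comp (hu : IsHeatSol c ν u) {I' : Type*} {ν' : J → I' → I'} (g : I' → I)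
    (e : Equiv.Perm J) (h : ∀ j x, g (ν' j x) = ν (e j) (g x)) :
    IsHeatSol c ν' fun x t => u (g x) t := by
  intro x t ht
  refine (hu (g x) t ht).congr_deriv ?_
  rw [← Equiv.sum_comp e]
  exact congrArg _ (Finset.sum_congr rfl fun j _ => by simp only [h])

/-- With `K = c * |J|` the diagonal term of the equation cancels and `u' + K u` is `c` times a sum
of `|J|` values of `u`, so a lower bound `-M` on these gives `-K M`. -/
lemma IsHeatSol.nonneg (hc : 0 ≤ c) (hu : IsHeatSol c ν u) (hb : LocBdd u)
    (h0 : ∀ x, 0 ≤ u x 0) (x : I) {t : ℝ} (ht : 0 ≤ t) : 0 ≤ u x t := by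
  refine nonneg_of_deriv_ge (K := c * Fintype.card J) (by positivity) hb hu h0 ?_ x ht
  intro t M _ _ hj i
  rw [Finset.sum_sub_distrib, Finset.sum_const, Finset.card_univ, nsmul_eq_mul]
  have : ∑ _j : J, -M ≤ ∑ j, u (ν j i) t := Finset.sum_le_sum fun j _ => hj _
  rw [Finset.sum_const, Finset.card_univ, nsmul_eq_mul] at this
  have := mul_le_mul_of_nonneg_left this hc
  linarith

/-- Uniqueness for the heat equation on a part `Ω` of the lattice with zero values outside. -/
lemma eq_zero_of_heat_on (hc : 0 ≤ c) (Ω : Set I) (hb : LocBdd u)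
    (hu : ∀ x ∈ Ω, ∀ t, 0 ≤ t →
      HasDerivWithinAt (u x) (c * ∑ j, (u (ν j x) t - u x t)) (Ici 0) t)
    (h0 : ∀ x, u x 0 = 0) (hΩ : ∀ x ∉ Ω, ∀ t, u x t = 0) (x : I) {t : ℝ} (ht : 0 ≤ t) :
    u x t = 0 := by
  classical
  have key : ∀ v : I → ℝ → ℝ, LocBdd v → (∀ x ∈ Ω, ∀ t, 0 ≤ t →
      HasDerivWithinAt (v x) (c * ∑ j, (v (ν j x) t - v x t)) (Ici 0) t) → (∀ x, v x 0 = 0) →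
      (∀ x ∉ Ω, ∀ t, v x t = 0) → 0 ≤ v x t := by
    intro v hb hv h0 hΩ
    -- Outside `Ω` the family is constantly zero, so it has derivative 0 there and the comparison
    -- principle applies on all of `I`.
    refine nonneg_of_deriv_ge (K := c * Fintype.card J)
      (w' := fun x t => if x ∈ Ω then c * ∑ j, (v (ν j x) t - v x t) else 0)
      (by positivity) hb ?_ (fun x => (h0 x).ge) ?_ x ht
    · intro i t ht
      by_cases hi : i ∈ Ω
      · simpa [hi] using hv i hi t ht
      · have : v i = fun _ => 0 := funext fun t => hΩ i hi t
        simpa [hi, this] using hasDerivWithinAt_const t (Ici (0 : ℝ)) (0 : ℝ)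
    · intro t M _ hM hj i
      by_cases hi : i ∈ Ω
      · simp only [hi, if_true]
        rw [Finset.sum_sub_distrib, Finset.sum_const, Finset.card_univ, nsmul_eq_mul]
        have : ∑ _j : J, -M ≤ ∑ j, v (ν j i) t := Finset.sum_le_sum fun j _ => hj _
        rw [Finset.sum_const, Finset.card_univ, nsmul_eq_mul] at this
        have := mul_le_mul_of_nonneg_left this hc
        linarith
      · simp only [hi, if_false, hΩ i hi t, mul_zero, add_zero, neg_nonpos]
        positivity
  refine le_antisymm ?_ (key u hb hu h0 hΩ)
  have := key (fun x t => -u x t) hb.neg (fun x hx t ht => by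
    refine (hu x hx t ht).neg.congr_deriv ?_
    rw [← mul_neg, ← Finset.sum_neg_distrib]
    congr 1
    exact Finset.sum_congr rfl fun _ _ => by ring) (fun x => by simp [h0 x])
    (fun x hx t => by simp [hΩ x hx t])
  linarith

lemma exists_hasDerivAt_linear {X : Type*} [NormedAddCommGroup X] [NormedSpace ℝ X]
    [CompleteSpace X] (L : X →L[ℝ] X) (F : X) :
    ∃ γ : ℝ → X, γ 0 = F ∧ ∀ t, HasDerivAt γ (L (γ t)) t :=
  ⟨fun s => NormedSpace.exp (s • L) F, by simp, fun t =>
    ((hasDerivAt_exp_smul_const' L t).clm_apply (hasDerivAt_const t F)).congr_deriv (by simp)⟩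

/-- Existence of a locally bounded solution of the heat equation. -/
lemma exists_isHeatSol (c : ℝ) (ν : J → I → I) (f : I → ℝ) {B : ℝ} (hf : ∀ x, |f x| ≤ B) :
    ∃ u : I → ℝ → ℝ, IsHeatSol c ν u ∧ LocBdd u ∧ ∀ x, u x 0 = f x := by
  -- In the discrete topology the bounded functions on `I` form a Banach space on which the jump
  -- operators `C j` are contractions. The generator is therefore bounded and its exponential solves
  -- the equation.
  let _ : TopologicalSpace I := ⊥
  have : DiscreteTopology I := ⟨rfl⟩
  let F : BoundedContinuousFunction I ℝ :=
    BoundedContinuousFunction.ofNormedAddCommGroupDiscrete f B hf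
  let C : J → (BoundedContinuousFunction I ℝ →L[ℝ] BoundedContinuousFunction I ℝ) := fun j =>
    LinearMap.mkContinuous
      { toFun := fun g => g.compContinuous ⟨ν j, continuous_of_discreteTopology⟩
        map_add' := fun _ _ => rfl
        map_smul' := fun _ _ => rfl } 1 (fun g => by
          rw [one_mul]
          exact (BoundedContinuousFunction.norm_le (norm_nonneg _)).2 fun x => g.norm_coe_le_norm _)
  let L : BoundedContinuousFunction I ℝ →L[ℝ] BoundedContinuousFunction I ℝ :=
    c • ∑ j, (C j - ContinuousLinearMap.id ℝ _)
  have hL : ∀ g x, L g x = c * ∑ j, (g (ν j x) - g x) := by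
    intro g x
    have h1 : L g = c • ∑ j, (C j g - g) := by simp [L]
    rw [h1, BoundedContinuousFunction.smul_apply, BoundedContinuousFunction.sum_apply]
    rfl
  obtain ⟨γ, hγ0, hγ⟩ := exists_hasDerivAt_linear L F
  refine ⟨fun x t => γ t x, ?_, ?_, ?_⟩
  · intro x t _
    rw [← hL]
    exact ((BoundedContinuousFunction.evalCLM ℝ x).hasFDerivAt.comp_hasDerivAt t
      (hγ t)).hasDerivWithinAt
  · intro T
    have hcont : Continuous γ := continuous_iff_continuousAt.2 fun t => (hγ t).continuousAt
    obtain ⟨B, hB⟩ := (isCompact_Icc (a := (0 : ℝ)) (b := T)).exists_bound_of_continuousOn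
      hcont.continuousOn
    exact ⟨B, fun x t h0 hT =>
      (BoundedContinuousFunction.norm_coe_le_norm _ x).trans (hB t ⟨h0, hT⟩)⟩
  · intro x
    simp [F, hγ0]

/-- Representation of locally bounded solutions by a kernel of total mass one. -/
lemma IsHeatSol.hasSum_kernel (hc : 0 ≤ c) (hu : IsHeatSol c ν u) (hb : LocBdd u)
    {Y : Type*} (e : Y ≃ I) {k : Y → I → ℝ → ℝ} (hk : ∀ y, IsHeatSol c ν (k y))
    (hkb : ∀ y, LocBdd (k y)) (hk0 : ∀ y x, k y x 0 = Set.indicator {e y} 1 x)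
    (hk1 : ∀ x t, 0 ≤ t → HasSum (fun y => k y x t) 1) {B : ℝ} (hB : ∀ x, |u x 0| ≤ B)
    (x : I) {t : ℝ} (ht : 0 ≤ t) : HasSum (fun y => k y x t * u (e y) 0) (u x t) := by
  classical
  have hknn : ∀ y, 0 ≤ k y x t := fun y => (hk y).nonneg hc (hkb y) (fun x => by
    rw [hk0]; exact Set.indicator_nonneg (by simp) _) x ht
  have hB0 : 0 ≤ B := (abs_nonneg _).trans (hB x)
  -- For nonnegative initial values a finite part of the kernel sum starts below `v`, hence stays
  -- below it.
  have key : ∀ v : I → ℝ → ℝ, IsHeatSol c ν v → LocBdd v → (∀ x, 0 ≤ v x 0) → ∀ s : Finset Y,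
      ∑ y ∈ s, k y x t * v (e y) 0 ≤ v x t := by
    intro v hv hvb hv0 s
    have hs : IsHeatSol c ν fun x t => v x t - ∑ y ∈ s, v (e y) 0 * k y x t :=
      hv.sub (.sum s fun y _ => (hk y).const_mul _)
    have hsb : LocBdd fun x t => v x t - ∑ y ∈ s, v (e y) 0 * k y x t :=
      hvb.sub (.sum s fun y _ =>
        (LocBdd.of_le (u := fun (_ : I) (_ : ℝ) => v (e y) 0) fun _ _ _ => le_rfl).mul (hkb y))
    have := hs.nonneg hc hsb (fun z => ?_) x ht
    · simp only [mul_comm (k _ x t)]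
      linarith
    · simp only [hk0, sub_nonneg]
      by_cases hz : e.symm z ∈ s
      · rw [Finset.sum_eq_single_of_mem _ hz]
        · simp
        · intro y _ hy
          rw [Set.indicator_of_notMem, mul_zero]
          rintro rfl
          simp at hy
      · rw [Finset.sum_eq_zero]
        · exact hv0 z
        · intro y hy
          rw [Set.indicator_of_notMem, mul_zero]
          rintro rfl
          simp [hy] at hz
  -- Applied to `B + u` and `B - u`, the bound gives two opposite inequalities. Since the kernel has
  -- mass one the constants `B` cancel.
  have hup := key (fun x t => B + u x t) ((isHeatSol_const B).add hu)
    ((LocBdd.of_le fun _ _ _ => le_rfl).add hb) (fun x => by linarith [neg_le_of_abs_le (hB x)])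
  have hdn := key (fun x t => B - u x t) ((isHeatSol_const B).sub hu)
    ((LocBdd.of_le fun _ _ _ => le_rfl).sub hb) (fun x => by linarith [le_of_abs_le (hB x)])
  have hsum : Summable fun y => k y x t * u (e y) 0 := by
    refine Summable.of_norm_bounded ((hk1 x t ht).summable.mul_right B) fun y => ?_
    rw [norm_mul, Real.norm_of_nonneg (hknn y)]
    exact mul_le_mul_of_nonneg_left (hB _) (hknn y)
  have h1 : B + ∑' y, k y x t * u (e y) 0 ≤ B + u x t := by
    have : HasSum (fun y => k y x t * (B + u (e y) 0)) (B + ∑' y, k y x t * u (e y) 0) := by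
      simpa only [one_mul, ← mul_add] using ((hk1 x t ht).mul_right B).add hsum.hasSum
    exact le_of_tendsto' this hup
  have h2 : B - ∑' y, k y x t * u (e y) 0 ≤ B - u x t := by
    have : HasSum (fun y => k y x t * (B - u (e y) 0)) (B - ∑' y, k y x t * u (e y) 0) := by
      simpa only [one_mul, ← mul_sub] using ((hk1 x t ht).mul_right B).sub hsum.hasSum
    exact le_of_tendsto' this hdn
  convert hsum.hasSum using 1
  linarith

end Heat

/-! ### The kernel of the simple random walk in continuous time -/

/-- The two jumps of a walk on `ℤ`. -/
def stepInt (b : Bool) (n : ℤ) : ℤ := if b then n + 1 else n - 1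

/-- The probability that a walk on `ℤ`, jumping to each neighbour at rate one, is displaced
by `n` at time `τ`. -/
def walkKernel (τ : ℝ) (n : ℤ) : ℝ :=
  (2 * Real.pi)⁻¹ *
    ∫ θ in (-Real.pi)..Real.pi, Real.exp (-2 * τ * (1 - Real.cos θ)) * Real.cos (n * θ)

/-- The centred Gaussian density of variance `2κ`. -/
def heatDensity (κ ξ : ℝ) : ℝ := (√(4 * Real.pi * κ))⁻¹ * Real.exp (-ξ ^ 2 / (4 * κ))

lemma isHeatSol_stepInt {c : ℝ} {u : ℤ → ℝ → ℝ} : IsHeatSol c stepInt u ↔ ∀ n t, 0 ≤ t →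
    HasDerivWithinAt (u n) (c * (u (n + 1) t + u (n - 1) t - 2 * u n t)) (Ici 0) t := by
  unfold IsHeatSol
  have : ∀ n t, ∑ j, (u (stepInt j n) t - u n t) = u (n + 1) t + u (n - 1) t - 2 * u n t := by
    intro n t
    simp [stepInt]
  simp only [this]

lemma walkKernel_neg (τ : ℝ) (n : ℤ) : walkKernel τ (-n) = walkKernel τ n := by
  simp [walkKernel]

lemma abs_walkKernel_le {τ : ℝ} (hτ : 0 ≤ τ) (n : ℤ) : |walkKernel τ n| ≤ 1 := by
  have hpi := Real.pi_pos
  have h : ‖∫ θ in (-Real.pi)..Real.pi,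
      Real.exp (-2 * τ * (1 - Real.cos θ)) * Real.cos (n * θ)‖ ≤ 1 * |Real.pi - -Real.pi| := by
    refine intervalIntegral.norm_integral_le_of_norm_le_const fun θ _ => ?_
    rw [norm_mul, Real.norm_eq_abs, Real.abs_exp]
    have h1 : Real.exp (-2 * τ * (1 - Real.cos θ)) ≤ 1 := by
      rw [Real.exp_le_one_iff]
      have := mul_nonneg hτ (sub_nonneg.2 (Real.cos_le_one θ))
      linarith
    exact mul_le_one₀ h1 (norm_nonneg _) (Real.abs_cos_le_one _)
  rw [walkKernel, abs_mul, abs_of_pos (by positivity), inv_mul_le_iff₀ (by positivity)]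
  rw [Real.norm_eq_abs] at h
  refine h.trans_eq ?_
  rw [abs_of_pos (by linarith)]
  ring

lemma walkKernel_zero (n : ℤ) : walkKernel 0 n = if n = 0 then 1 else 0 := by
  have hpi := Real.pi_pos
  unfold walkKernel
  split_ifs with h
  · subst h
    simp
    field_simp
    norm_num
  · have hn : (n : ℝ) ≠ 0 := by exact_mod_cast h
    simp [intervalIntegral.integral_comp_mul_left (fun x => Real.cos x) hn]

/-- Differentiation under the integral produces the symbol `-2 (1 - cos θ)` of the discrete
Laplacian, by the addition formulas for `cos ((n ± 1) θ)`. -/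
lemma hasDerivAt_walkKernel (τ : ℝ) (n : ℤ) : HasDerivAt (fun τ => walkKernel τ n)
    (walkKernel τ (n + 1) + walkKernel τ (n - 1) - 2 * walkKernel τ n) τ := by
  have hint : ∀ m : ℤ, IntervalIntegrable
      (fun θ => Real.exp (-2 * τ * (1 - Real.cos θ)) * Real.cos (m * θ)) volume
      (-Real.pi) Real.pi := fun m => Continuous.intervalIntegrable (by fun_prop) _ _
  -- The bound uses `|σ| ≤ |τ| + 1` on the unit ball and `0 ≤ 1 - cos θ ≤ 2`.
  have h := intervalIntegral.hasDerivAt_integral_of_dominated_loc_of_deriv_le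
    (μ := volume) (a := -Real.pi) (b := Real.pi) (x₀ := τ) (s := Metric.ball τ 1)
    (bound := fun _ => Real.exp (4 * (|τ| + 1)) * 4)
    (F := fun τ θ => Real.exp (-2 * τ * (1 - Real.cos θ)) * Real.cos (n * θ))
    (F' := fun τ θ => Real.exp (-2 * τ * (1 - Real.cos θ)) *
      (-2 * (1 - Real.cos θ)) * Real.cos (n * θ))
    (Metric.ball_mem_nhds τ one_pos)
    (Eventually.of_forall fun τ => Continuous.aestronglyMeasurable (by fun_prop))
    (hint n) (Continuous.aestronglyMeasurable (by fun_prop))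
    (Eventually.of_forall fun θ _ σ hσ => ?_) (by simp)
    (Eventually.of_forall fun θ _ σ _ => ?_)
  · refine (h.2.const_mul (2 * Real.pi)⁻¹).congr_deriv ?_
    unfold walkKernel
    rw [← mul_add, mul_left_comm, ← mul_sub, ← intervalIntegral.integral_const_mul 2,
      ← intervalIntegral.integral_add (hint _) (hint _),
      ← intervalIntegral.integral_sub ((hint _).add (hint _)) ((hint _).const_mul _)]
    congr 1
    refine intervalIntegral.integral_congr fun θ _ => ?_
    push_cast
    simp only [add_mul, sub_mul, one_mul, Real.cos_add, Real.cos_sub]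
    ring
  · have h1 := Real.neg_one_le_cos θ
    have h2 := Real.cos_le_one θ
    rw [norm_mul, norm_mul, Real.norm_eq_abs, Real.abs_exp]
    have h3 : |σ| ≤ |τ| + 1 := by
      have : |σ - τ| < 1 := by simpa [Real.dist_eq] using hσ
      have := abs_sub_abs_le_abs_sub σ τ
      linarith
    have h4 : Real.exp (-2 * σ * (1 - Real.cos θ)) ≤ Real.exp (4 * (|τ| + 1)) := by
      rw [Real.exp_le_exp]
      have := neg_abs_le σ
      nlinarith [abs_nonneg σ]
    have h5 : ‖-2 * (1 - Real.cos θ)‖ ≤ 4 := by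
      rw [Real.norm_eq_abs, abs_le]
      constructor <;> linarith
    calc _ ≤ Real.exp (4 * (|τ| + 1)) * 4 * 1 := by
          gcongr
          exact Real.abs_cos_le_one _
      _ = _ := mul_one _
  · refine (HasDerivAt.mul_const ?_ _)
    refine HasDerivAt.exp ?_
    exact (((hasDerivAt_id σ).const_mul (-2)).mul_const (1 - Real.cos θ)).congr_deriv (by simp)

lemma hasDerivAt_walkKernel_mul (c t : ℝ) (n : ℤ) : HasDerivAt (fun t => walkKernel (c * t) n)
    (c * (walkKernel (c * t) (n + 1) + walkKernel (c * t) (n - 1) - 2 * walkKernel (c * t) n))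
    t := by
  have h := (hasDerivAt_walkKernel (c * t) n).comp t ((hasDerivAt_id t).const_mul c)
  exact h.congr_deriv (by ring)

lemma isHeatSol_walkKernel (c : ℝ) (m : ℤ) :
    IsHeatSol c stepInt fun n t => walkKernel (c * t) (n - m) := by
  rw [isHeatSol_stepInt]
  intro n t _
  refine (hasDerivAt_walkKernel_mul c t (n - m)).hasDerivWithinAt.congr_deriv ?_
  rw [sub_add_eq_add_sub, sub_right_comm]

lemma locBdd_walkKernel {c : ℝ} (hc : 0 ≤ c) (m : ℤ) :
    LocBdd fun n t => walkKernel (c * t) (n - m) :=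
  .of_le fun _ _ ht => abs_walkKernel_le (mul_nonneg hc ht) _

/-- Positivity is not visible in the oscillating integral; it follows from the comparison principle,
since the kernel starts from a unit mass at 0. -/
lemma walkKernel_nonneg {τ : ℝ} (hτ : 0 ≤ τ) (n : ℤ) : 0 ≤ walkKernel τ n := by
  have := (isHeatSol_walkKernel 1 0).nonneg zero_le_one (locBdd_walkKernel zero_le_one 0)
    (fun x => by rw [mul_zero, walkKernel_zero]; split_ifs <;> norm_num) n hτ
  simpa using this

/-- One minus a finite sum of translated kernels is a solution with nonnegative initial values, so
every partial sum is at most 1. -/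
lemma summable_walkKernel {τ : ℝ} (hτ : 0 ≤ τ) : Summable (walkKernel τ) := by
  refine summable_of_sum_le (walkKernel_nonneg hτ) (c := 1) fun s => ?_
  have h : IsHeatSol 1 stepInt fun n t => 1 - ∑ m ∈ s, walkKernel (1 * t) (n - m) :=
    (isHeatSol_const 1).sub (.sum s fun m _ => isHeatSol_walkKernel 1 m)
  have hb : LocBdd fun (n : ℤ) t => 1 - ∑ m ∈ s, walkKernel (1 * t) (n - m) :=
    (LocBdd.of_le (B := 1) (by simp)).sub (.sum s fun m _ => locBdd_walkKernel zero_le_one m)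
  have := h.nonneg zero_le_one hb (fun n => ?_) 0 hτ
  · simpa [walkKernel_neg] using this
  · simp only [mul_zero, walkKernel_zero, sub_eq_zero, Finset.sum_ite_eq]
    split_ifs <;> norm_num

/-- The kernel is the sequence of Fourier coefficients of `exp (-2τ (1 - cos θ))`. Being summable,
its Fourier series converges pointwise, and its value at `θ = 0` is 1. -/
lemma hasSum_walkKernel {τ : ℝ} (hτ : 0 ≤ τ) : HasSum (walkKernel τ) 1 := by
  have hpi := Real.pi_pos
  have : Fact (0 < 2 * Real.pi) := ⟨by positivity⟩
  let f : C(AddCircle (2 * Real.pi), ℂ) :=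
    ⟨fun θ => ((Real.exp (-2 * τ * (1 - Real.Angle.cos θ)) : ℝ) : ℂ), by
      have := Real.Angle.continuous_cos
      exact Complex.continuous_ofReal.comp (Real.continuous_exp.comp
        (continuous_const.mul (continuous_const.sub this)))⟩
  have hcoe : ∀ n, fourierCoeff f n = (walkKernel τ n : ℂ) := by
    intro n
    rw [fourierCoeff_eq_intervalIntegral f n (-Real.pi), show -Real.pi + 2 * Real.pi = Real.pi by ring]
    -- The imaginary part of the coefficient has an odd integrand.
    have h0 : ∫ x in (-Real.pi)..Real.pi, Real.exp (-2 * τ * (1 - Real.cos x)) * Real.sin (n * x)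
        = 0 := by
      have h := intervalIntegral.integral_comp_neg (a := -Real.pi) (b := Real.pi)
        (fun x => Real.exp (-2 * τ * (1 - Real.cos x)) * Real.sin (n * x))
      simp only [Real.cos_neg, mul_neg, Real.sin_neg, neg_neg, intervalIntegral.integral_neg] at h
      linarith
    have h1 : ∀ x : ℝ, (fourier (-n) (x : AddCircle (2 * Real.pi)) : ℂ) • f x =
        ((Real.exp (-2 * τ * (1 - Real.cos x)) * Real.cos (n * x) : ℝ) : ℂ) -
        Complex.I * ((Real.exp (-2 * τ * (1 - Real.cos x)) * Real.sin (n * x) : ℝ) : ℂ) := by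
      intro x
      have : f x = ((Real.exp (-2 * τ * (1 - Real.cos x)) : ℝ) : ℂ) := rfl
      rw [fourier_coe_apply, this, smul_eq_mul]
      have h2 : (2 * Real.pi * Complex.I * ((-n : ℤ) : ℂ) * x / ((2 * Real.pi : ℝ) : ℂ) : ℂ)
          = ((-(n * x) : ℝ) : ℂ) * Complex.I := by
        have : (Real.pi : ℂ) ≠ 0 := by exact_mod_cast hpi.ne'
        push_cast
        field_simp
      rw [h2, Complex.exp_mul_I, ← Complex.ofReal_cos, ← Complex.ofReal_sin, Real.cos_neg,
        Real.sin_neg]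
      push_cast
      ring
    simp only [h1]
    rw [intervalIntegral.integral_sub, intervalIntegral.integral_const_mul,
      intervalIntegral.integral_ofReal, intervalIntegral.integral_ofReal, h0]
    · simp [walkKernel]
    · exact Continuous.intervalIntegrable (by fun_prop) _ _
    · exact Continuous.intervalIntegrable (by fun_prop) _ _
  have hsum : Summable (fourierCoeff f) := by
    rw [show fourierCoeff f = fun n => (walkKernel τ n : ℂ) from funext hcoe]
    exact Complex.summable_ofReal.2 (summable_walkKernel hτ)
  have h := has_pointwise_sum_fourier_series_of_summable hsum 0
  have hf0 : f 0 = 1 := by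
    have : f 0 = ((Real.exp (-2 * τ * (1 - Real.Angle.cos 0)) : ℝ) : ℂ) := rfl
    rw [this, Real.Angle.cos_zero]
    simp
  simp only [hcoe, fourier_eval_zero, smul_eq_mul, mul_one, hf0] at h
  exact Complex.hasSum_ofReal.1 (by simpa using h)

/-! ### The local limit theorem -/

lemma integral_exp_mul_cos {κ : ℝ} (hκ : 0 < κ) (ξ : ℝ) :
    (2 * Real.pi)⁻¹ * ∫ s : ℝ, Real.exp (-κ * s ^ 2) * Real.cos (ξ * s) = heatDensity κ ξ := by
  have hpi := Real.pi_pos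
  have h := fourierIntegral_gaussian (b := (κ : ℂ)) (by simpa using hκ) (ξ : ℂ)
  have h1 : ∀ x : ℝ, Complex.exp (Complex.I * ξ * x) * Complex.exp (-(κ : ℂ) * x ^ 2) =
      ((Real.exp (-κ * x ^ 2) : ℝ) : ℂ) * Complex.exp ((ξ * x : ℝ) * Complex.I) := by
    intro x
    rw [mul_comm]
    push_cast
    ring_nf
  have h2 : Integrable fun x : ℝ =>
      Complex.exp (Complex.I * ξ * x) * Complex.exp (-(κ : ℂ) * x ^ 2) := by
    refine Integrable.mono' (integrable_exp_neg_mul_sq hκ)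
      (Continuous.aestronglyMeasurable (by fun_prop)) (Eventually.of_forall fun x => ?_)
    rw [h1, norm_mul, Complex.norm_exp_ofReal_mul_I, mul_one, Complex.norm_real, Real.norm_eq_abs,
      Real.abs_exp]
  have h3 := congrArg Complex.re h
  rw [← RCLike.re_eq_complex_re, ← integral_re h2] at h3
  have h4 : ((Real.pi : ℂ) / κ) ^ (1 / 2 : ℂ) * Complex.exp (-(ξ : ℂ) ^ 2 / (4 * κ)) =
      ((√(Real.pi / κ) * Real.exp (-ξ ^ 2 / (4 * κ)) : ℝ) : ℂ) := by
    rw [Real.sqrt_eq_rpow, Complex.ofReal_mul, Complex.ofReal_cpow (by positivity)]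
    push_cast
    rfl
  rw [h4] at h3
  simp only [h1, RCLike.re_eq_complex_re, Complex.re_ofReal_mul, Complex.exp_ofReal_mul_I_re,
    Complex.ofReal_re] at h3
  rw [h3, heatDensity, ← mul_assoc]
  congr 1
  rw [Real.sqrt_div hpi.le, show 4 * Real.pi * κ = 2 ^ 2 * Real.pi * κ by norm_num,
    Real.sqrt_mul (by positivity), Real.sqrt_mul (by positivity), Real.sqrt_sq (by norm_num)]
  have := Real.sq_sqrt hpi.le
  have h5 : √Real.pi ≠ 0 := by positivity
  have h6 : √κ ≠ 0 := by positivity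
  field_simp
  linarith

/-- This is `1 - cos θ = 2 sin² (θ / 2)`, written with `sinc` so that `s = 0` needs no separate
treatment. -/
lemma tendsto_one_sub_cos_div {a : ℕ → ℝ} (ha : ∀ k, 0 < a k) (ha0 : Tendsto a atTop (𝓝 0))
    (s : ℝ) : Tendsto (fun k => (1 - Real.cos (a k * s)) / a k ^ 2) atTop (𝓝 (s ^ 2 / 2)) := by
  have hs : ∀ x, x * Real.sinc x = Real.sin x := by
    intro x
    by_cases hx : x = 0
    · simp [hx]
    · rw [Real.sinc_of_ne_zero hx]; field_simp
  have h1 : ∀ k, (1 - Real.cos (a k * s)) / a k ^ 2 =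
      s ^ 2 / 2 * Real.sinc (a k * (s / 2)) ^ 2 := by
    intro k
    have h := Real.cos_sq' (a k * (s / 2))
    rw [Real.cos_sq, show 2 * (a k * (s / 2)) = a k * s by ring, ← hs] at h
    rw [div_eq_iff (pow_pos (ha k) 2).ne']
    linear_combination (-2) * h
  simp only [h1]
  have h2 : Tendsto (fun k => Real.sinc (a k * (s / 2))) atTop (𝓝 1) := by
    have := (Real.continuous_sinc.tendsto (0 * (s / 2))).comp (ha0.mul_const (s / 2))
    simpa [Function.comp_def] using this
  simpa using (h2.pow 2).const_mul (s ^ 2 / 2)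

/-- Local limit theorem: under diffusive scaling the walk kernel converges to the Gaussian. -/
lemma tendsto_walkKernel {κ : ℝ} (hκ : 0 < κ) {a : ℕ → ℝ} (ha : ∀ k, 0 < a k)
    (ha0 : Tendsto a atTop (𝓝 0)) {N : ℕ → ℤ} {ξ : ℝ}
    (hN : Tendsto (fun k => a k * N k) atTop (𝓝 ξ)) :
    Tendsto (fun k => (a k)⁻¹ * walkKernel (κ / a k ^ 2) (N k)) atTop
      (𝓝 (heatDensity κ ξ)) := by
  have hpi := Real.pi_pos
  -- Substituting `θ = a k * s` cancels the prefactor and moves the cutoff to `π / a k`, which tends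
  -- to infinity.
  have hrw : ∀ k, (a k)⁻¹ * walkKernel (κ / a k ^ 2) (N k) = (2 * Real.pi)⁻¹ * ∫ s : ℝ,
      (Ioc (-Real.pi / a k) (Real.pi / a k)).indicator (fun s =>
        Real.exp (-2 * κ * ((1 - Real.cos (a k * s)) / a k ^ 2)) *
          Real.cos (a k * N k * s)) s := by
    intro k
    have hk := ha k
    have h := intervalIntegral.integral_comp_mul_left (a := -Real.pi / a k) (b := Real.pi / a k)
      (fun θ => Real.exp (-2 * (κ / a k ^ 2) * (1 - Real.cos θ)) * Real.cos (N k * θ)) hk.ne'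
    rw [mul_div_cancel₀ _ hk.ne', mul_div_cancel₀ _ hk.ne', smul_eq_mul] at h
    rw [walkKernel, mul_left_comm, ← h, integral_indicator measurableSet_Ioc,
      intervalIntegral.integral_of_le (by gcongr; linarith)]
    congr 2
    ext s
    congr 2 <;> ring
  simp only [hrw, ← integral_exp_mul_cos hκ ξ]
  refine Tendsto.const_mul _ ?_
  -- The Gaussian bound comes from `1 - cos θ ≥ (2 / π²) θ²` for `|θ| ≤ π`.
  refine tendsto_integral_of_dominated_convergence
    (fun s => Real.exp (-(4 * κ / Real.pi ^ 2) * s ^ 2)) ?_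
    (integrable_exp_neg_mul_sq (by positivity)) ?_ ?_
  · intro k
    exact (Continuous.aestronglyMeasurable (by fun_prop)).indicator measurableSet_Ioc
  · refine fun k => Eventually.of_forall fun s => ?_
    have hk := ha k
    by_cases hs : s ∈ Ioc (-Real.pi / a k) (Real.pi / a k)
    · rw [indicator_of_mem hs, norm_mul, Real.norm_eq_abs, Real.abs_exp]
      have habs : |a k * s| ≤ Real.pi := by
        have h1 := (div_lt_iff₀ hk).1 hs.1
        have h2 := (le_div_iff₀ hk).1 hs.2
        rw [abs_le]
        constructor <;> linarith
      have hcos := Real.cos_le_one_sub_mul_cos_sq habs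
      have hdiv : 2 / Real.pi ^ 2 * s ^ 2 ≤ (1 - Real.cos (a k * s)) / a k ^ 2 := by
        rw [le_div_iff₀ (by positivity)]
        linarith
      refine (mul_le_of_le_one_right (Real.exp_pos _).le (Real.abs_cos_le_one _)).trans ?_
      rw [Real.exp_le_exp]
      have h3 := mul_le_mul_of_nonneg_left hdiv hκ.le
      have h4 : 4 * κ / Real.pi ^ 2 * s ^ 2 = 2 * (κ * (2 / Real.pi ^ 2 * s ^ 2)) := by ring
      linarith
    · rw [indicator_of_notMem hs, norm_zero]
      exact (Real.exp_pos _).le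
  · refine Eventually.of_forall fun s => ?_
    have hev : ∀ᶠ k in atTop, s ∈ Ioc (-Real.pi / a k) (Real.pi / a k) := by
      have h1 : Tendsto (fun k => a k * s) atTop (𝓝 0) := by simpa using ha0.mul_const s
      filter_upwards [h1.eventually_lt_const hpi, h1.eventually_const_lt (neg_lt_zero.2 hpi)]
        with k h2 h3
      constructor
      · rw [div_lt_iff₀ (ha k)]; linarith
      · rw [le_div_iff₀ (ha k)]; linarith
    have h2 : Tendsto (fun k => Real.exp (-2 * κ * ((1 - Real.cos (a k * s)) / a k ^ 2)) *
        Real.cos (a k * N k * s)) atTop (𝓝 (Real.exp (-κ * s ^ 2) * Real.cos (ξ * s))) := by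
      refine Tendsto.mul ?_ ((Real.continuous_cos.tendsto _).comp (hN.mul_const s))
      refine (Real.continuous_exp.tendsto _).comp ?_
      convert (tendsto_one_sub_cos_div ha ha0 s).const_mul (-2 * κ) using 2
      ring
    refine h2.congr' ?_
    filter_upwards [hev] with k hk
    rw [indicator_of_mem hk]

/-! ### Convergence of lattice sums to integrals -/

/-- Scheffé's lemma, tested against uniformly bounded, pointwise convergent functions. -/
lemma tendsto_integral_mul_of_density {X : Type*} [MeasurableSpace X] {m : Measure X}
    {f : ℕ → X → ℝ} {f' : X → ℝ} {g : ℕ → X → ℝ} {g' : X → ℝ}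
    (hf : ∀ k, Integrable (f k) m) (hf0 : ∀ k x, 0 ≤ f k x)
    (hf' : Integrable f' m) (hf'0 : ∀ x, 0 ≤ f' x) (hmass : ∀ k, ∫ x, f k x ∂m = ∫ x, f' x ∂m)
    (hlim : ∀ᵐ x ∂m, Tendsto (fun k => f k x) atTop (𝓝 (f' x)))
    (hg : ∀ k, AEStronglyMeasurable (g k) m) (hg1 : ∀ k x, |g k x| ≤ 1)
    (hglim : ∀ᵐ x ∂m, Tendsto (fun k => g k x) atTop (𝓝 (g' x))) :
    Tendsto (fun k => ∫ x, f k x * g k x ∂m) atTop (𝓝 (∫ x, f' x * g' x ∂m)) := by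
  have hfs : ∀ k, Integrable (fun x => f k x - f' x) m := fun k => (hf k).sub hf'
  have hfp : ∀ k, Integrable (fun x => max (f' x - f k x) 0) m := fun k =>
    (hf'.sub (hf k)).pos_part
  -- The positive part of `f' - f k` is dominated by `f'`, although `f k` itself has no common
  -- majorant.
  have hpos : Tendsto (fun k => ∫ x, max (f' x - f k x) 0 ∂m) atTop (𝓝 0) := by
    have h := tendsto_integral_of_dominated_convergence (μ := m)
      (F := fun k x => max (f' x - f k x) 0) (f := fun _ => 0) f'
      (fun k => (hfp k).aestronglyMeasurable) hf'
      (fun k => Eventually.of_forall fun x => ?_) ?_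
    · simpa using h
    · rw [Real.norm_of_nonneg (le_max_right _ _)]
      exact max_le (by linarith [hf0 k x]) (hf'0 x)
    · filter_upwards [hlim] with x hx
      have h1 : Tendsto (fun k => f' x - f k x) atTop (𝓝 0) := by
        simpa using (tendsto_const_nhds (x := f' x)).sub hx
      simpa using h1.max (tendsto_const_nhds (x := (0 : ℝ)))
  have hL1 : Tendsto (fun k => ∫ x, |f k x - f' x| ∂m) atTop (𝓝 0) := by
    have h1 : ∀ k, ∫ x, |f k x - f' x| ∂m = 2 * ∫ x, max (f' x - f k x) 0 ∂m := by
      intro k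
      -- The last summand integrates to zero because the masses agree, so the `L¹` distance is twice
      -- the integral of the positive part.
      have h2 : ∀ x, |f k x - f' x| = 2 * max (f' x - f k x) 0 + (f k x - f' x) := by
        intro x
        rcases le_total (f k x) (f' x) with h | h
        · rw [abs_of_nonpos (by linarith), max_eq_left (by linarith)]; ring
        · rw [abs_of_nonneg (by linarith), max_eq_right (by linarith)]; ring
      simp only [h2]
      rw [integral_add ((hfp k).const_mul 2) (hfs k),
        integral_const_mul, integral_sub (hf k) hf', hmass, sub_self, add_zero]
    simp only [h1]
    simpa using hpos.const_mul 2
  have hint : ∀ k (F : X → ℝ), Integrable F m → Integrable (fun x => F x * g k x) m := by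
    intro k F hF
    refine hF.mono (hF.aestronglyMeasurable.mul (hg k)) (Eventually.of_forall fun x => ?_)
    rw [norm_mul]
    exact mul_le_of_le_one_right (norm_nonneg _) (hg1 k x)
  have h2 : Tendsto (fun k => ∫ x, f' x * g k x ∂m) atTop (𝓝 (∫ x, f' x * g' x ∂m)) := by
    refine tendsto_integral_of_dominated_convergence f' (fun k => (hint k f' hf').1) hf'
      (fun k => Eventually.of_forall fun x => ?_) ?_
    · rw [norm_mul, Real.norm_of_nonneg (hf'0 x)]
      exact mul_le_of_le_one_right (hf'0 x) (hg1 k x)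
    · filter_upwards [hglim] with x hx
      exact hx.const_mul _
  have h3 : Tendsto (fun k => ∫ x, (f k x - f' x) * g k x ∂m) atTop (𝓝 0) := by
    refine squeeze_zero_norm (fun k => ?_) hL1
    refine (norm_integral_le_integral_norm _).trans
      (integral_mono (hint k _ (hfs k)).norm (hfs k).abs fun x => ?_)
    simp only [norm_mul, Real.norm_eq_abs]
    exact mul_le_of_le_one_right (abs_nonneg _) (hg1 k x)
  have h4 := h3.add h2
  rw [zero_add] at h4
  refine h4.congr fun k => ?_
  rw [← integral_add (hint k _ (hfs k)) (hint k _ hf')]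
  exact integral_congr_ae (Eventually.of_forall fun x => by simp only; ring)

/-- Convergence of lattice averages, where `φ k` sends the points of a cell of volume `b k` to
the corresponding lattice point. -/
lemma tendsto_tsum_mul_of_cells {X Y : Type*} [MeasurableSpace X] {m : Measure X}
    [MeasurableSpace Y] [DiscreteMeasurableSpace Y] {φ : ℕ → X → Y} (hφ : ∀ k, Measurable (φ k))
    {b : ℕ → ℝ} (hb : ∀ k, 0 < b k)
    (hcell : ∀ k (F : Y → ENNReal), ∫⁻ x, F (φ k x) ∂m = ENNReal.ofReal (b k) * ∑' y, F y)
    {P : ℕ → Y → ℝ} (hP0 : ∀ k y, 0 ≤ P k y) (hP : ∀ k, HasSum (P k) 1)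
    {f : X → ℝ} (hf0 : ∀ x, 0 ≤ f x) (hf : Integrable f m) (hf1 : ∫ x, f x ∂m = 1)
    (hlim : ∀ᵐ x ∂m, Tendsto (fun k => (b k)⁻¹ * P k (φ k x)) atTop (𝓝 (f x)))
    {G : ℕ → Y → ℝ} (hG0 : ∀ k y, 0 ≤ G k y) (hG1 : ∀ k y, G k y ≤ 1) {g : X → ℝ}
    (hg : ∀ᵐ x ∂m, Tendsto (fun k => G k (φ k x)) atTop (𝓝 (g x))) :
    Tendsto (fun k => ∑' y, P k y * G k y) atTop (𝓝 (∫ x, f x * g x ∂m)) := by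
  -- Lattice sums become integrals of functions constant on cells, with the cell volume `b k` as
  -- factor.
  have hsum : ∀ k (F : Y → ℝ), (∀ y, 0 ≤ F y) → Summable F →
      Integrable (fun x => F (φ k x)) m ∧ ∫ x, F (φ k x) ∂m = b k * ∑' y, F y := by
    intro k F hF0 hF
    have hmeas : AEStronglyMeasurable (fun x => F (φ k x)) m :=
      (Measurable.of_discrete.comp (hφ k)).aestronglyMeasurable
    have h1 : ∫⁻ x, ENNReal.ofReal (F (φ k x)) ∂m = ENNReal.ofReal (b k * ∑' y, F y) := by
      rw [hcell k fun y => ENNReal.ofReal (F y), ENNReal.ofReal_mul (hb k).le,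
        ENNReal.ofReal_tsum_of_nonneg hF0 hF]
    constructor
    · refine ⟨hmeas, ?_⟩
      rw [hasFiniteIntegral_iff_ofReal (Eventually.of_forall fun x => hF0 _), h1]
      exact ENNReal.ofReal_lt_top
    · rw [integral_eq_lintegral_of_nonneg_ae (Eventually.of_forall fun x => hF0 _) hmeas, h1,
        ENNReal.toReal_ofReal (mul_nonneg (hb k).le (tsum_nonneg hF0))]
  have hPG : ∀ k, Summable fun y => P k y * G k y := fun k =>
    (hP k).summable.of_nonneg_of_le (fun y => mul_nonneg (hP0 k y) (hG0 k y))
      fun y => mul_le_of_le_one_right (hP0 k y) (hG1 k y)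
  have h := tendsto_integral_mul_of_density (m := m) (f := fun k x => (b k)⁻¹ * P k (φ k x))
    (f' := f) (g := fun k x => G k (φ k x)) (g' := g)
    (fun k => ((hsum k _ (hP0 k) (hP k).summable).1).const_mul _)
    (fun k x => mul_nonneg (inv_nonneg.2 (hb k).le) (hP0 _ _)) hf hf0 (fun k => by
      rw [integral_const_mul, (hsum k _ (hP0 k) (hP k).summable).2, (hP k).tsum_eq, hf1,
        mul_one, inv_mul_cancel₀ (hb k).ne']) hlim
    (fun k => (Measurable.of_discrete.comp (hφ k)).aestronglyMeasurable)
    (fun k x => by rw [abs_of_nonneg (hG0 _ _)]; exact hG1 _ _) hg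
  refine h.congr fun k => ?_
  simp only [mul_assoc]
  rw [integral_const_mul, (hsum k _ (fun y => mul_nonneg (hP0 k y) (hG0 k y)) (hPG k)).2,
    inv_mul_cancel_left₀ (hb k).ne']

lemma lintegral_floor_div {a : ℝ} (ha : 0 < a) (F : ℤ → ENNReal) :
    ∫⁻ v : ℝ, F ⌊v / a⌋ = ENNReal.ofReal a * ∑' n, F n := by
  have hm : Measurable fun v : ℝ => ⌊v / a⌋ := (measurable_id.div_const a).floor
  rw [← lintegral_map (f := F) Measurable.of_discrete hm, lintegral_countable',
    ← ENNReal.tsum_mul_left]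
  refine tsum_congr fun n => ?_
  rw [Measure.map_apply hm (measurableSet_singleton n), mul_comm]
  congr 1
  have : (fun v : ℝ => ⌊v / a⌋) ⁻¹' {n} = Ico (n * a) ((n + 1) * a) := by
    ext v
    simp only [mem_preimage, mem_singleton_iff, Int.floor_eq_iff, mem_Ico, le_div_iff₀ ha,
      div_lt_iff₀ ha]
  rw [this, Real.volume_Ico]
  congr 1
  ring

lemma tendsto_mul_floor_div {a : ℕ → ℝ} (ha : ∀ k, 0 < a k) (ha0 : Tendsto a atTop (𝓝 0))
    (v : ℝ) : Tendsto (fun k => a k * (⌊v / a k⌋ : ℤ)) atTop (𝓝 v) := by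
  have h : Tendsto (fun k => v - a k) atTop (𝓝 v) := by
    simpa using tendsto_const_nhds.sub ha0
  refine tendsto_of_tendsto_of_tendsto_of_le_of_le h tendsto_const_nhds (fun k => ?_) fun k => ?_
  · have := (div_lt_iff₀ (ha k)).1 (Int.lt_floor_add_one (v / a k))
    simp only
    linarith
  · have := (le_div_iff₀ (ha k)).1 (Int.floor_le (v / a k))
    simp only
    linarith

/-! ### Gaussian densities -/

lemma heatDensity_nonneg (κ ξ : ℝ) : 0 ≤ heatDensity κ ξ := by
  unfold heatDensity; positivity

@[fun_prop]
lemma continuous_heatDensity (κ : ℝ) : Continuous (heatDensity κ) := by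
  unfold heatDensity; fun_prop

lemma heatDensity_eq (κ ξ : ℝ) :
    heatDensity κ ξ = (√(4 * Real.pi * κ))⁻¹ * Real.exp (-(4 * κ)⁻¹ * ξ ^ 2) := by
  rw [heatDensity]
  congr 2
  ring

lemma integrable_heatDensity {κ : ℝ} (hκ : 0 < κ) : Integrable (heatDensity κ) := by
  simp only [funext (heatDensity_eq κ)]
  exact (integrable_exp_neg_mul_sq (by positivity)).const_mul _

lemma integral_heatDensity {κ : ℝ} (hκ : 0 < κ) : ∫ ξ, heatDensity κ ξ = 1 := by
  simp only [heatDensity_eq κ]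
  rw [integral_const_mul, integral_gaussian, div_inv_eq_mul,
    show Real.pi * (4 * κ) = 4 * Real.pi * κ by ring]
  have := Real.pi_pos
  exact inv_mul_cancel₀ (by positivity)

lemma lintegral_heatDensity {κ : ℝ} (hκ : 0 < κ) :
    ∫⁻ ξ, ENNReal.ofReal (heatDensity κ ξ) = 1 := by
  rw [← ofReal_integral_eq_lintegral_ofReal (integrable_heatDensity hκ)
    (Eventually.of_forall (heatDensity_nonneg κ)), integral_heatDensity hκ, ENNReal.ofReal_one]

/-- Continuum limit of averages over one lattice coordinate. -/
lemma tendsto_tsum_walkKernel {κ : ℝ} (hκ : 0 < κ) {a : ℕ → ℝ} (ha : ∀ k, 0 < a k)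
    (ha0 : Tendsto a atTop (𝓝 0)) {N : ℕ → ℤ} {ξ : ℝ}
    (hN : Tendsto (fun k => a k * N k) atTop (𝓝 ξ)) {G : ℕ → ℤ → ℝ} (hG0 : ∀ k n, 0 ≤ G k n)
    (hG1 : ∀ k n, G k n ≤ 1) {g : ℝ → ℝ}
    (hg : ∀ᵐ v, Tendsto (fun k => G k ⌊v / a k⌋) atTop (𝓝 (g v))) :
    Tendsto (fun k => ∑' n, walkKernel (κ / a k ^ 2) (N k - n) * G k n) atTop
      (𝓝 (∫ v, heatDensity κ (ξ - v) * g v)) := by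
  have hτ : ∀ k, 0 ≤ κ / a k ^ 2 := fun k => by have := ha k; positivity
  have hP : ∀ k, HasSum (fun n => walkKernel (κ / a k ^ 2) (N k - n)) 1 := fun k =>
    (Equiv.subLeft (N k)).hasSum_iff.2 (hasSum_walkKernel (hτ k))
  refine tendsto_tsum_mul_of_cells (φ := fun k v => ⌊v / a k⌋) (b := a)
    (P := fun k n => walkKernel (κ / a k ^ 2) (N k - n)) (f := fun v => heatDensity κ (ξ - v))
    (fun k => (measurable_id.div_const _).floor) ha (fun k F => lintegral_floor_div (ha k) F)
    (fun k n => walkKernel_nonneg (hτ k) _)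
    hP
    (fun v => heatDensity_nonneg _ _) ((integrable_heatDensity hκ).comp_sub_left ξ)
    (by rw [integral_sub_left_eq_self (heatDensity κ)]; exact integral_heatDensity hκ)
    (Eventually.of_forall fun v => ?_) hG0 hG1 hg
  refine tendsto_walkKernel hκ ha ha0 ?_
  push_cast
  simp only [mul_sub]
  exact hN.sub (tendsto_mul_floor_div ha ha0 v)

/-! ### Pairs of intervals -/

/-- The four endpoints of a pair of intervals of lengths `q.1.1`, `q.1.2.1` with gap `q.1.2.2`,
the second of which starts at `q.2`. -/
def ends {R : Type*} [Ring R] (q : (R × R × R) × R) : Fin 4 → R :=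
  ![q.2 - q.1.2.2 - q.1.1, q.2 - q.1.2.2, q.2, q.2 + q.1.2.1]

/-- A pair of intervals is determined by its endpoints. -/
def endsEquiv : (ℤ × ℤ × ℤ) × ℤ ≃ (Fin 4 → ℤ) where
  toFun := ends
  invFun y := ((y 1 - y 0, y 3 - y 2, y 2 - y 1), y 2)
  left_inv q := by simp [ends]
  right_inv y := by
    ext i
    fin_cases i <;> simp [ends]

/-- Coordinatewise integer parts of the quotients by `a`. -/
def floorCell (a : ℝ) (q : (ℝ × ℝ × ℝ) × ℝ) : (ℤ × ℤ × ℤ) × ℤ :=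
  ((⌊q.1.1 / a⌋, ⌊q.1.2.1 / a⌋, ⌊q.1.2.2 / a⌋), ⌊q.2 / a⌋)

lemma measurable_floorCell (a : ℝ) : Measurable (floorCell a) := by
  unfold floorCell
  have h : Measurable fun v : ℝ => ⌊v / a⌋ := (measurable_id.div_const a).floor
  exact ((h.comp (by fun_prop)).prodMk ((h.comp (by fun_prop)).prodMk
    (h.comp (by fun_prop)))).prodMk (h.comp (by fun_prop))

lemma lintegral_floorCell {a : ℝ} (ha : 0 < a) (F : (ℤ × ℤ × ℤ) × ℤ → ENNReal) :
    ∫⁻ q, F (floorCell a q) = ENNReal.ofReal (a ^ 4) * ∑' q, F q := by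
  have hm : Measurable fun q => F (floorCell a q) :=
    Measurable.of_discrete.comp (measurable_floorCell a)
  have e1 : ∫⁻ q, F (floorCell a q) = ∫⁻ x : ℝ, ∫⁻ y : ℝ, ∫⁻ z : ℝ, ∫⁻ u : ℝ,
      F ((⌊x / a⌋, ⌊y / a⌋, ⌊z / a⌋), ⌊u / a⌋) := by
    rw [Measure.volume_eq_prod, lintegral_prod _ hm.aemeasurable, Measure.volume_eq_prod,
      lintegral_prod _ hm.lintegral_prod_right'.aemeasurable]
    refine lintegral_congr fun x => ?_
    rw [Measure.volume_eq_prod, lintegral_prod]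
    · rfl
    · exact (hm.lintegral_prod_right'.comp measurable_prodMk_left).aemeasurable
  rw [e1]
  have s1 := fun p => lintegral_floor_div ha fun u => F (p, u)
  have s2 := fun x y => lintegral_floor_div ha fun z => ENNReal.ofReal a * ∑' u, F ((x, y, z), u)
  have s3 := fun x => lintegral_floor_div ha fun y => ENNReal.ofReal a *
    ∑' z, ENNReal.ofReal a * ∑' u, F ((x, y, z), u)
  have s4 := lintegral_floor_div ha fun x => ENNReal.ofReal a * ∑' y, ENNReal.ofReal a *
    ∑' z, ENNReal.ofReal a * ∑' u, F ((x, y, z), u)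
  simp only [s1, s2, s3, s4]
  simp only [ENNReal.tsum_mul_left, ENNReal.tsum_prod', ENNReal.ofReal_pow ha.le]
  ring

lemma hasSum_prod_walkKernel {τ : ℝ} (hτ : 0 ≤ τ) (x : Fin 4 → ℤ) :
    HasSum (fun q => ∏ i, walkKernel τ (x i - ends q i)) 1 := by
  -- In `ENNReal` the order of summation is free. The endpoints depend on the coordinates
  -- triangularly: for fixed `q.2` the sums over `q.1.1`, `q.1.2.1` and `q.1.2.2` can be done one
  -- after another, each giving 1.
  set H : ℤ → ENNReal := fun n => ENNReal.ofReal (walkKernel τ n) with hH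
  have h0 : ∑' n, H n = 1 := by
    rw [← ENNReal.ofReal_tsum_of_nonneg (walkKernel_nonneg hτ) (summable_walkKernel hτ),
      (hasSum_walkKernel hτ).tsum_eq, ENNReal.ofReal_one]
  have h1 : ∀ c, ∑' n, H (c - n) = 1 := fun c => by
    rw [← h0]; exact (Equiv.subLeft c).tsum_eq H
  have h2 : ∀ c, ∑' n, H (c + n) = 1 := fun c => by
    rw [← h0]; exact (Equiv.addLeft c).tsum_eq H
  have key : ∑' q : (ℤ × ℤ × ℤ) × ℤ, ENNReal.ofReal (∏ i, walkKernel τ (x i - ends q i)) = 1 := by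
    have e : ∀ q : (ℤ × ℤ × ℤ) × ℤ, ENNReal.ofReal (∏ i, walkKernel τ (x i - ends q i)) =
        H (x 2 - q.2) * (H (x 1 - q.2 + q.1.2.2) * (H (x 3 - q.2 - q.1.2.1) *
          H (x 0 - q.2 + q.1.2.2 + q.1.1))) := by
      intro q
      rw [ENNReal.ofReal_prod_of_nonneg fun i _ => walkKernel_nonneg hτ _, Fin.prod_univ_four]
      simp only [ends, hH, Matrix.cons_val]
      rw [show x 0 - (q.2 - q.1.2.2 - q.1.1) = x 0 - q.2 + q.1.2.2 + q.1.1 by ring,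
        show x 1 - (q.2 - q.1.2.2) = x 1 - q.2 + q.1.2.2 by ring,
        show x 3 - (q.2 + q.1.2.1) = x 3 - q.2 - q.1.2.1 by ring]
      ring
    simp only [e]
    rw [ENNReal.tsum_prod', ENNReal.tsum_comm]
    simp only [ENNReal.tsum_mul_left]
    have hin : ∀ u : ℤ, ∑' p : ℤ × ℤ × ℤ, H (x 1 - u + p.2.2) * (H (x 3 - u - p.2.1) *
        H (x 0 - u + p.2.2 + p.1)) = 1 := by
      intro u
      rw [ENNReal.tsum_prod', ENNReal.tsum_comm]
      simp only [ENNReal.tsum_mul_left, h2, mul_one]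
      rw [ENNReal.tsum_prod', ENNReal.tsum_comm]
      simp only [ENNReal.tsum_mul_left, h1, h2, mul_one]
    simp only [hin, mul_one, h1]
  have hnn : ∀ q : (ℤ × ℤ × ℤ) × ℤ, 0 ≤ ∏ i, walkKernel τ (x i - ends q i) :=
    fun q => Finset.prod_nonneg fun i _ => walkKernel_nonneg hτ _
  have hs : Summable fun q : (ℤ × ℤ × ℤ) × ℤ => ∏ i, walkKernel τ (x i - ends q i) := by
    have := ENNReal.summable_toReal (key.trans_ne ENNReal.one_ne_top)
    simpa only [ENNReal.toReal_ofReal (hnn _)] using this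
  rw [← ENNReal.ofReal_tsum_of_nonneg hnn hs] at key
  have := hs.hasSum
  rwa [(ENNReal.ofReal_eq_one).1 key] at this

lemma continuous_prod_heatDensity (κ : ℝ) (ξ : Fin 4 → ℝ) :
    Continuous fun q : (ℝ × ℝ × ℝ) × ℝ => ∏ i, heatDensity κ (ξ i - ends q i) := by
  simp only [Fin.prod_univ_four, ends, Matrix.cons_val]
  fun_prop

lemma lintegral_prod_heatDensity {κ : ℝ} (hκ : 0 < κ) (ξ : Fin 4 → ℝ) :
    ∫⁻ q : (ℝ × ℝ × ℝ) × ℝ, ENNReal.ofReal (∏ i, heatDensity κ (ξ i - ends q i)) = 1 := by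
  set H : ℝ → ENNReal := fun v => ENNReal.ofReal (heatDensity κ v) with hH
  have hHm : Measurable H := ENNReal.measurable_ofReal.comp (continuous_heatDensity κ).measurable
  have h1 : ∀ c, ∫⁻ v, H (c - v) = 1 := fun c => by
    rw [lintegral_sub_left_eq_self H]; exact lintegral_heatDensity hκ
  have h2 : ∀ c, ∫⁻ v, H (c + v) = 1 := fun c => by
    rw [lintegral_add_left_eq_self H]; exact lintegral_heatDensity hκ
  have e : ∀ q : (ℝ × ℝ × ℝ) × ℝ, ENNReal.ofReal (∏ i, heatDensity κ (ξ i - ends q i)) =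
      H (ξ 2 - q.2) * (H (ξ 1 - q.2 + q.1.2.2) * (H (ξ 3 - q.2 - q.1.2.1) *
        H (ξ 0 - q.2 + q.1.2.2 + q.1.1))) := by
    intro q
    rw [ENNReal.ofReal_prod_of_nonneg fun i _ => heatDensity_nonneg _ _, Fin.prod_univ_four]
    simp only [ends, hH, Matrix.cons_val]
    rw [show ξ 0 - (q.2 - q.1.2.2 - q.1.1) = ξ 0 - q.2 + q.1.2.2 + q.1.1 by ring,
      show ξ 1 - (q.2 - q.1.2.2) = ξ 1 - q.2 + q.1.2.2 by ring,
      show ξ 3 - (q.2 + q.1.2.1) = ξ 3 - q.2 - q.1.2.1 by ring]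
    ring
  simp only [e]
  rw [Measure.volume_eq_prod, lintegral_prod_symm _ (by fun_prop)]
  have hin : ∀ u : ℝ, ∫⁻ p : ℝ × ℝ × ℝ, H (ξ 1 - u + p.2.2) * (H (ξ 3 - u - p.2.1) *
      H (ξ 0 - u + p.2.2 + p.1)) = 1 := by
    intro u
    rw [Measure.volume_eq_prod, lintegral_prod_symm _ (by fun_prop)]
    have : ∀ r : ℝ × ℝ, ∫⁻ x, H (ξ 1 - u + r.2) * (H (ξ 3 - u - r.1) *
        H (ξ 0 - u + r.2 + x)) = H (ξ 1 - u + r.2) * H (ξ 3 - u - r.1) := by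
      intro r
      rw [lintegral_const_mul _ (by fun_prop), lintegral_const_mul _ (by fun_prop), h2, mul_one]
    simp only [this]
    rw [Measure.volume_eq_prod, lintegral_prod_symm _ (by fun_prop)]
    have : ∀ z : ℝ, ∫⁻ y, H (ξ 1 - u + z) * H (ξ 3 - u - y) = H (ξ 1 - u + z) := by
      intro z
      rw [lintegral_const_mul _ (by fun_prop), h1, mul_one]
    simp only [this, h2]
  have : ∀ u : ℝ, ∫⁻ p : ℝ × ℝ × ℝ, H (ξ 2 - u) * (H (ξ 1 - u + p.2.2) * (H (ξ 3 - u - p.2.1) *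
      H (ξ 0 - u + p.2.2 + p.1))) = H (ξ 2 - u) := by
    intro u
    rw [lintegral_const_mul _ (by fun_prop), hin, mul_one]
  simp only [this, h1]

lemma prod_heatDensity_nonneg (κ : ℝ) (ξ : Fin 4 → ℝ) (q : (ℝ × ℝ × ℝ) × ℝ) :
    0 ≤ ∏ i, heatDensity κ (ξ i - ends q i) :=
  Finset.prod_nonneg fun _ _ => heatDensity_nonneg _ _

lemma integrable_prod_heatDensity {κ : ℝ} (hκ : 0 < κ) (ξ : Fin 4 → ℝ) :
    Integrable fun q : (ℝ × ℝ × ℝ) × ℝ => ∏ i, heatDensity κ (ξ i - ends q i) := by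
  refine ⟨(continuous_prod_heatDensity κ ξ).aestronglyMeasurable, ?_⟩
  rw [hasFiniteIntegral_iff_ofReal (Eventually.of_forall (prod_heatDensity_nonneg κ ξ)),
    lintegral_prod_heatDensity hκ]
  exact ENNReal.one_lt_top

lemma integral_prod_heatDensity {κ : ℝ} (hκ : 0 < κ) (ξ : Fin 4 → ℝ) :
    ∫ q : (ℝ × ℝ × ℝ) × ℝ, ∏ i, heatDensity κ (ξ i - ends q i) = 1 := by
  rw [integral_eq_lintegral_of_nonneg_ae (Eventually.of_forall (prod_heatDensity_nonneg κ ξ))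
    (continuous_prod_heatDensity κ ξ).aestronglyMeasurable, lintegral_prod_heatDensity hκ,
    ENNReal.toReal_one]

/-- Continuum limit of averages over the endpoints of pairs of intervals. -/
lemma tendsto_tsum_prod_walkKernel {κ : ℝ} (hκ : 0 < κ) {a : ℕ → ℝ} (ha : ∀ k, 0 < a k)
    (ha0 : Tendsto a atTop (𝓝 0)) {N : ℕ → Fin 4 → ℤ} {ξ : Fin 4 → ℝ}
    (hN : ∀ i, Tendsto (fun k => a k * N k i) atTop (𝓝 (ξ i)))
    {G : ℕ → (ℤ × ℤ × ℤ) × ℤ → ℝ} (hG0 : ∀ k n, 0 ≤ G k n) (hG1 : ∀ k n, G k n ≤ 1)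
    {g : (ℝ × ℝ × ℝ) × ℝ → ℝ}
    (hg : ∀ᵐ q, Tendsto (fun k => G k (floorCell (a k) q)) atTop (𝓝 (g q))) :
    Tendsto (fun k => ∑' q, (∏ i, walkKernel (κ / a k ^ 2) (N k i - ends q i)) * G k q) atTop
      (𝓝 (∫ q, (∏ i, heatDensity κ (ξ i - ends q i)) * g q)) := by
  have hτ : ∀ k, 0 ≤ κ / a k ^ 2 := fun k => by have := ha k; positivity
  refine tendsto_tsum_mul_of_cells (φ := fun k => floorCell (a k)) (b := fun k => a k ^ 4)
    (fun k => measurable_floorCell _) (fun k => pow_pos (ha k) 4)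
    (fun k F => lintegral_floorCell (ha k) F)
    (fun k q => Finset.prod_nonneg fun i _ => walkKernel_nonneg (hτ k) _)
    (fun k => hasSum_prod_walkKernel (hτ k) _)
    (prod_heatDensity_nonneg κ ξ) (integrable_prod_heatDensity hκ ξ)
    (integral_prod_heatDensity hκ ξ) (Eventually.of_forall fun q => ?_) hG0 hG1 hg
  have hends : ∀ i, Tendsto (fun k => a k * (ends (floorCell (a k) q) i : ℤ)) atTop
      (𝓝 (ends q i)) := by
    have hf := fun v => tendsto_mul_floor_div ha ha0 v
    intro i
    fin_cases i
    · have := ((hf q.2).sub (hf q.1.2.2)).sub (hf q.1.1)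
      simpa [ends, floorCell, mul_sub] using this
    · have := (hf q.2).sub (hf q.1.2.2)
      simpa [ends, floorCell, mul_sub] using this
    · simpa [ends, floorCell] using hf q.2
    · have := (hf q.2).add (hf q.1.2.1)
      simpa [ends, floorCell, mul_add] using this
  have h : Tendsto (fun k => ∏ i, (a k)⁻¹ * walkKernel (κ / a k ^ 2)
      (N k i - ends (floorCell (a k) q) i)) atTop (𝓝 (∏ i, heatDensity κ (ξ i - ends q i))) := by
    refine tendsto_finsetProd _ fun i _ => tendsto_walkKernel hκ ha ha0 ?_
    push_cast
    simp only [mul_sub]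
    exact (hN i).sub (hends i)
  refine h.congr fun k => ?_
  rw [Finset.prod_mul_distrib]
  simp

/-! ### The empty-interval equations -/

/-- The jumps of a system of walks: the walk `j.1` makes the step `j.2`. -/
def stepVec {ι : Type*} [DecidableEq ι] (j : ι × Bool) (x : ι → ℤ) : ι → ℤ :=
  Function.update x j.1 (stepInt j.2 (x j.1))

lemma sum_stepVec {ι : Type*} [DecidableEq ι] [Fintype ι] (u : (ι → ℤ) → ℝ) (x : ι → ℤ) :
    ∑ j, (u (stepVec j x) - u x) = ∑ k, (u (Function.update x k (x k + 1)) +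
      u (Function.update x k (x k - 1)) - 2 * u x) := by
  rw [Fintype.sum_prod_type]
  refine Finset.sum_congr rfl fun k _ => ?_
  simp only [stepVec, stepInt, Fintype.sum_bool, if_true, Bool.false_eq_true, if_false]
  ring

/-- The indicator of the event that all sites in `S` are empty. -/
def emptyInd (S : Finset ℤ) (η : Config) : ℝ :=
  Set.indicator {η | ∀ i ∈ S, η i = false} 1 η

lemma emptyInd_of_forall {S : Finset ℤ} {η : Config} (h : ∀ i ∈ S, η i = false) :
    emptyInd S η = 1 := indicator_of_mem (s := {η : Config | ∀ i ∈ S, η i = false}) h _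

lemma emptyInd_of_not_forall {S : Finset ℤ} {η : Config} (h : ¬∀ i ∈ S, η i = false) :
    emptyInd S η = 0 := indicator_of_notMem (s := {η : Config | ∀ i ∈ S, η i = false}) h _

lemma emptyInd_congr {S S' : Finset ℤ} {η η' : Config}
    (h : (∀ i ∈ S, η i = false) ↔ ∀ i ∈ S', η' i = false) : emptyInd S η = emptyInd S' η' := by
  by_cases h' : ∀ i ∈ S, η i = false
  · rw [emptyInd_of_forall h', emptyInd_of_forall (h.1 h')]
  · rw [emptyInd_of_not_forall h', emptyInd_of_not_forall (mt h.2 h')]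

lemma dependsOn_emptyInd (S : Finset ℤ) : DependsOn (emptyInd S) (S : Set ℤ) := by
  intro η η' h
  exact emptyInd_congr (forall₂_congr fun i hi => by rw [h i hi])

lemma measurableSet_empty (S : Finset ℤ) :
    MeasurableSet {η : Config | ∀ i ∈ S, η i = false} := by
  have : {η : Config | ∀ i ∈ S, η i = false} = ⋂ i ∈ S, (fun η : Config => η i) ⁻¹' {false} := by
    ext η; simp
  rw [this]
  exact Finset.measurableSet_biInter S fun i _ => measurable_pi_apply i (measurableSet_singleton _)

lemma integral_emptyInd (ν : Measure Config) (S : Finset ℤ) :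
    ∫ η, emptyInd S η ∂ν = emptyProb ν S :=
  integral_indicator_one (measurableSet_empty S)

lemma integrable_emptyInd (ν : Measure Config) [IsFiniteMeasure ν] (S : Finset ℤ) :
    Integrable (emptyInd S) ν :=
  (integrable_const (1 : ℝ)).indicator (measurableSet_empty S)

/-- The effect on an empty-set indicator of hops from `i` to `j`. -/
lemma emptyInd_hop (S : Finset ℤ) {i j : ℤ} (hij : i ≠ j) (η : Config) :
    (if η i = true then emptyInd S (hop η i j) - emptyInd S η else 0) =
      (if j ∈ S then emptyInd (insert i S) η else emptyInd (S.erase i) η) - emptyInd S η := by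
  by_cases hi : η i = true
  · rw [if_pos hi]
    congr 1
    -- If `j ∈ S`, the hop fills `S`, and `insert i S` is not empty because `i` is occupied. If `j ∉
    -- S`, the hop clears `i`, so only `S.erase i` has to be empty beforehand.
    split_ifs with hj
    · rw [emptyInd_of_not_forall, emptyInd_of_not_forall]
      · intro h
        simp [h i (by simp)] at hi
      · intro h
        simpa [hop] using h j hj
    · refine emptyInd_congr ⟨fun h l hl => ?_, fun h l hl => ?_⟩
      · have hl' := Finset.mem_erase.1 hl
        have hlj : l ≠ j := by rintro rfl; exact hj hl'.2
        simpa [hop, hlj, hl'.1] using h l hl'.2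
      · have hlj : l ≠ j := by rintro rfl; exact hj hl
        by_cases hli : l = i
        · subst hli; simp [hop, hlj]
        · simpa [hop, hlj, hli] using h l (Finset.mem_erase.2 ⟨hli, hl⟩)
  -- For an empty site `i` the right side vanishes too, since adding or removing `i` does not change
  -- the event. The occupation factor thus drops out and the equations close.
  · rw [if_neg hi, eq_comm, sub_eq_zero]
    rw [Bool.not_eq_true] at hi
    split_ifs with hj
    · exact emptyInd_congr (by simp [hi])
    · refine emptyInd_congr ⟨fun h l hl => ?_, fun h l hl => h l (Finset.mem_erase.1 hl).2⟩
      by_cases hli : l = i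
      · rwa [hli]
      · exact h l (Finset.mem_erase.2 ⟨hli, hl⟩)

/-- The generator on the indicator that a union `S` of intervals with endpoints `x k` is empty;
`U k` and `L k` are the sets with the endpoint `x k` moved up and down. -/
lemma generator_emptyInd (Γ : ℝ) (S : Finset ℤ) {ι : Type*} [Fintype ι] {x : ι → ℤ}
    (hx : Function.Injective x) (hS : ∀ i, ¬(i ∈ S ↔ i - 1 ∈ S) → i ∈ range x)
    {U L : ι → Finset ℤ}
    (hU : ∀ k, U k = if x k - 1 ∈ S then insert (x k) S else S.erase (x k))
    (hL : ∀ k, L k = if x k ∈ S then insert (x k - 1) S else S.erase (x k - 1)) (η : Config) :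
    generator Γ (emptyInd S) η =
      Γ * ∑ k, (emptyInd (U k) η + emptyInd (L k) η - 2 * emptyInd S η) := by
  classical
  have hsplit : ∀ i : ℤ, (if η i = true then (emptyInd S (hop η i (i + 1)) - emptyInd S η) +
      (emptyInd S (hop η i (i - 1)) - emptyInd S η) else 0) =
      ((if i + 1 ∈ S then emptyInd (insert i S) η else emptyInd (S.erase i) η) - emptyInd S η) +
      ((if i - 1 ∈ S then emptyInd (insert i S) η else emptyInd (S.erase i) η) -
        emptyInd S η) := by
    intro i
    rw [← emptyInd_hop S (by omega : i ≠ i + 1), ← emptyInd_hop S (by omega : i ≠ i - 1)]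
    split_ifs <;> simp
  -- Hops within `S` or within its complement contribute nothing.
  have hzero : ∀ i j : ℤ, (i ∈ S ↔ j ∈ S) →
      (if j ∈ S then emptyInd (insert i S) η else emptyInd (S.erase i) η) - emptyInd S η = 0 := by
    intro i j h
    rw [sub_eq_zero]
    split_ifs with hj
    · rw [Finset.insert_eq_of_mem (h.2 hj)]
    · rw [Finset.erase_eq_of_notMem (mt h.1 hj)]
  -- An endpoint `x k` marks the bond between `x k - 1` and `x k`. Downward hops contribute from `x
  -- k` and move the endpoint up; upward hops contribute from `x k - 1` and move it down.
  have hdown : Function.support (fun i : ℤ =>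
      (if i - 1 ∈ S then emptyInd (insert i S) η else emptyInd (S.erase i) η) - emptyInd S η) ⊆
      (Finset.univ.image x : Finset ℤ) := by
    intro i hi
    have := hS i fun h => hi (hzero i (i - 1) h)
    simpa using this
  have hup : Function.support (fun i : ℤ =>
      (if i + 1 ∈ S then emptyInd (insert i S) η else emptyInd (S.erase i) η) - emptyInd S η) ⊆
      (Finset.univ.image fun k => x k - 1 : Finset ℤ) := by
    intro i hi
    have := hS (i + 1) fun h => hi (hzero i (i + 1) (by rw [h, add_sub_cancel_right]))
    obtain ⟨k, hk⟩ := this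
    simp only [Finset.coe_image, Finset.coe_univ, image_univ]
    exact ⟨k, by simp [hk]⟩
  unfold generator
  simp only [hsplit]
  rw [finsum_add_distrib ((Finset.finite_toSet _).subset hup)
    ((Finset.finite_toSet _).subset hdown), finsum_eq_sum_of_support_subset _ hup,
    finsum_eq_sum_of_support_subset _ hdown, Finset.sum_image fun k _ l _ h => hx h,
    Finset.sum_image fun k _ l _ h => hx (by simpa using h), ← Finset.sum_add_distrib]
  congr 1
  refine Finset.sum_congr rfl fun k _ => ?_
  rw [hU, hL, sub_add_cancel]
  split_ifs <;> ring

/-- The master equation for the empty probabilities. -/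
lemma IsLaw.hasDerivWithinAt_emptyProb {Γ : ℝ} {μ : ℝ → Measure Config} (hμ : IsLaw Γ μ)
    (S : Finset ℤ) {ι : Type*} [Fintype ι] {x : ι → ℤ}
    (hx : Function.Injective x) (hS : ∀ i, ¬(i ∈ S ↔ i - 1 ∈ S) → i ∈ range x)
    {U L : ι → Finset ℤ}
    (hU : ∀ k, U k = if x k - 1 ∈ S then insert (x k) S else S.erase (x k))
    (hL : ∀ k, L k = if x k ∈ S then insert (x k - 1) S else S.erase (x k - 1))
    {t : ℝ} (ht : 0 ≤ t) :
    HasDerivWithinAt (fun s => emptyProb (μ s) S)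
      (Γ * ∑ k, (emptyProb (μ t) (U k) + emptyProb (μ t) (L k) - 2 * emptyProb (μ t) S))
      (Ici 0) t := by
  have := hμ.isProbabilityMeasure t ht
  have hI := integrable_emptyInd (μ t)
  have h := hμ.master (emptyInd S) S (dependsOn_emptyInd S) t ht
  simp only [integral_emptyInd, generator_emptyInd Γ S hx hS hU hL] at h
  refine h.congr_deriv ?_
  have hI2 : ∀ k, Integrable (fun η => emptyInd (U k) η + emptyInd (L k) η) (μ t) := fun k =>
    (hI _).add (hI _)
  have hI3 : ∀ k, Integrable
      (fun η => emptyInd (U k) η + emptyInd (L k) η - 2 * emptyInd S η) (μ t) := fun k =>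
    (hI2 k).sub ((hI S).const_mul 2)
  rw [integral_const_mul, integral_finsetSum _ fun k _ => hI3 k]
  congr 1
  refine Finset.sum_congr rfl fun k _ => ?_
  rw [integral_sub (hI2 k) ((hI _).const_mul 2), integral_add (hI _) (hI _),
    integral_const_mul, integral_emptyInd, integral_emptyInd, integral_emptyInd]

/-- The sites of an interval. -/
def block (x : Fin 2 → ℤ) : Finset ℤ := Finset.Ico (x 0) (x 1)

/-- The sites of a pair of intervals. -/
def blocks (x : Fin 4 → ℤ) : Finset ℤ := Finset.Ico (x 0) (x 1) ∪ Finset.Ico (x 2) (x 3)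

/-- Strict ordering is essential: coincident endpoints delimit no site, so moving them would not
correspond to inserting or erasing a boundary site. -/
lemma IsLaw.hasDerivWithinAt_block {Γ : ℝ} {μ : ℝ → Measure Config} (hμ : IsLaw Γ μ)
    {x : Fin 2 → ℤ} (hx : x 0 < x 1) {t : ℝ} (ht : 0 ≤ t) :
    HasDerivWithinAt (fun s => emptyProb (μ s) (block x))
      (Γ * ∑ j, (emptyProb (μ t) (block (stepVec j x)) - emptyProb (μ t) (block x)))
      (Ici 0) t := by
  rw [sum_stepVec fun x => emptyProb (μ t) (block x)]
  refine hμ.hasDerivWithinAt_emptyProb (block x) (x := x) ?_ ?_ ?_ ?_ ht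
  · intro k l h
    fin_cases k <;> fin_cases l <;>
      first | rfl | (simp only [Fin.isValue, Fin.zero_eta, Fin.mk_one] at h; omega)
  · intro i hi
    simp only [block, Finset.mem_Ico] at hi
    have : i = x 0 ∨ i = x 1 := by omega
    rcases this with h | h <;> exact ⟨_, h.symm⟩
  · intro k
    ext i
    fin_cases k <;> simp [block] <;> (try split_ifs) <;> (try simp) <;> omega
  · intro k
    ext i
    fin_cases k <;> simp [block] <;> (try split_ifs) <;> (try simp) <;> omega

lemma IsLaw.hasDerivWithinAt_blocks {Γ : ℝ} {μ : ℝ → Measure Config} (hμ : IsLaw Γ μ)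
    {x : Fin 4 → ℤ} (h0 : x 0 < x 1) (h1 : x 1 < x 2) (h2 : x 2 < x 3) {t : ℝ} (ht : 0 ≤ t) :
    HasDerivWithinAt (fun s => emptyProb (μ s) (blocks x))
      (Γ * ∑ j, (emptyProb (μ t) (blocks (stepVec j x)) - emptyProb (μ t) (blocks x)))
      (Ici 0) t := by
  rw [sum_stepVec fun x => emptyProb (μ t) (blocks x)]
  refine hμ.hasDerivWithinAt_emptyProb (blocks x) (x := x) ?_ ?_ ?_ ?_ ht
  · refine StrictMono.injective (Fin.strictMono_iff_lt_succ.2 fun i => ?_)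
    fin_cases i
    exacts [h0, h1, h2]
  · intro i hi
    simp only [blocks, Finset.mem_union, Finset.mem_Ico] at hi
    have : i = x 0 ∨ i = x 1 ∨ i = x 2 ∨ i = x 3 := by omega
    rcases this with h | h | h | h <;> exact ⟨_, h.symm⟩
  · intro k
    ext i
    fin_cases k <;> simp [blocks] <;> (try split_ifs) <;> (try simp) <;> omega
  · intro k
    ext i
    fin_cases k <;> simp [blocks] <;> (try split_ifs) <;> (try simp) <;> omega

/-! ### Solutions of the lattice heat equation with images -/

lemma sub_step (p q : ℤ) : p + 1 - q = p - q + 1 ∧ p - 1 - q = p - q - 1 ∧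
    p - (q + 1) = p - q - 1 ∧ p - (q - 1) = p - q + 1 := by
  refine ⟨?_, ?_, ?_, ?_⟩ <;> ring

lemma isHeatSol_stepVec {ι : Type*} [DecidableEq ι] [Fintype ι] {c : ℝ} {u : (ι → ℤ) → ℝ → ℝ} :
    IsHeatSol c stepVec u ↔ ∀ x t, 0 ≤ t → HasDerivWithinAt (u x)
      (c * ∑ k, (u (Function.update x k (x k + 1)) t + u (Function.update x k (x k - 1)) t -
        2 * u x t)) (Ici 0) t := by
  have h : ∀ x t, ∑ j, (u (stepVec j x) t - u x t) = ∑ k, (u (Function.update x k (x k + 1)) t +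
      u (Function.update x k (x k - 1)) t - 2 * u x t) := fun x t => sum_stepVec (fun x => u x t) x
  unfold IsHeatSol
  simp only [h]

/-- The representation of bounded solutions on `ℤ` by the walk kernel. -/
lemma IsHeatSol.hasSum_walkKernel {c : ℝ} (hc : 0 ≤ c) {u : ℤ → ℝ → ℝ}
    (hu : IsHeatSol c stepInt u) (hb : LocBdd u) {B : ℝ} (hB : ∀ x, |u x 0| ≤ B) (n : ℤ) {t : ℝ}
    (ht : 0 ≤ t) : HasSum (fun m => walkKernel (c * t) (n - m) * u m 0) (u n t) :=
  hu.hasSum_kernel hc hb (Equiv.refl ℤ) (k := fun m n t => walkKernel (c * t) (n - m))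
    (fun m => isHeatSol_walkKernel c m) (fun m => locBdd_walkKernel hc m)
    (fun m n => by
      rw [mul_zero, walkKernel_zero, indicator_apply]
      simp [sub_eq_zero])
    (fun n t ht => (Equiv.subLeft n).hasSum_iff.2
      (CoagulationDiffusion.hasSum_walkKernel (mul_nonneg hc ht))) hB n ht

lemma isHeatSol_prod_walkKernel (c : ℝ) (y : Fin 4 → ℤ) :
    IsHeatSol c stepVec fun x t => ∏ i, walkKernel (c * t) (x i - y i) := by
  rw [isHeatSol_stepVec]
  intro x t _
  have h := fun i : Fin 4 => (hasDerivAt_walkKernel_mul c t (x i - y i))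
  simp only [Fin.prod_univ_four]
  refine ((((h 0).mul (h 1)).mul (h 2)).mul (h 3)).hasDerivWithinAt.congr_deriv ?_
  have hs := fun p q => (sub_step p q).1
  have hs' := fun p q => (sub_step p q).2.1
  simp [Fin.sum_univ_four, Function.update_apply, hs, hs']
  ring

lemma abs_prod_walkKernel_le {τ : ℝ} (hτ : 0 ≤ τ) (x : Fin 4 → ℤ) :
    |∏ i, walkKernel τ (x i)| ≤ 1 := by
  rw [Finset.abs_prod]
  exact Finset.prod_le_one (fun _ _ => abs_nonneg _) fun _ _ => abs_walkKernel_le hτ _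

/-- The representation of bounded solutions on `ℤ⁴`, in terms of pairs of intervals. -/
lemma IsHeatSol.hasSum_prod_walkKernel {c : ℝ} (hc : 0 ≤ c) {u : (Fin 4 → ℤ) → ℝ → ℝ}
    (hu : IsHeatSol c stepVec u) (hb : LocBdd u) {B : ℝ} (hB : ∀ x, |u x 0| ≤ B)
    (x : Fin 4 → ℤ) {t : ℝ} (ht : 0 ≤ t) :
    HasSum (fun q => (∏ i, walkKernel (c * t) (x i - ends q i)) * u (ends q) 0) (u x t) :=
  hu.hasSum_kernel hc hb endsEquiv
    (k := fun q x t => ∏ i, walkKernel (c * t) (x i - ends q i))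
    (fun q => isHeatSol_prod_walkKernel c _)
    (fun q => .of_le fun x t ht => abs_prod_walkKernel_le (mul_nonneg hc ht) fun i => x i - ends q i)
    (fun q x => by
      simp only [mul_zero, walkKernel_zero, indicator_apply, mem_singleton_iff]
      rw [Finset.prod_ite_zero]
      simp [sub_eq_zero, endsEquiv, funext_iff])
    (fun x t ht => CoagulationDiffusion.hasSum_prod_walkKernel (mul_nonneg hc ht) x) hB x ht

/-- Reflection of walks on `ℤ`. -/
lemma IsHeatSol.comp_neg {c : ℝ} {u : ℤ → ℝ → ℝ} (hu : IsHeatSol c stepInt u) :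
    IsHeatSol c stepInt fun n t => u (-n) t :=
  hu.comp (fun n : ℤ => -n) Equiv.boolNot (by
    intro b n
    cases b <;> simp [stepInt] <;> ring)

/-- Permutation of the walks of a system. -/
lemma IsHeatSol.comp_perm {ι : Type*} [DecidableEq ι] [Fintype ι] {c : ℝ}
    {u : (ι → ℤ) → ℝ → ℝ} (hu : IsHeatSol c stepVec u) (σ : Equiv.Perm ι) :
    IsHeatSol c stepVec fun x t => u (x ∘ σ) t :=
  hu.comp (fun x : ι → ℤ => x ∘ σ) (Equiv.prodCongr σ.symm (Equiv.refl Bool)) (by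
    intro j x
    ext i
    simp only [stepVec, Function.comp_apply, Function.update_apply, Equiv.prodCongr_apply,
      Prod.map_fst, Prod.map_snd, Equiv.refl_apply, Equiv.apply_symm_apply, Equiv.eq_symm_apply])

/-- The restriction of `f` to the positive integers. -/
def posPart (f : ℤ → ℝ) (n : ℤ) : ℝ := if 0 < n then f n else 0

lemma posPart_nonneg {f : ℤ → ℝ} (hf : ∀ n, 0 ≤ f n) (n : ℤ) : 0 ≤ posPart f n := by
  unfold posPart; split_ifs; exacts [hf n, le_rfl]

lemma posPart_le_one {f : ℤ → ℝ} (hf : ∀ n, f n ≤ 1) (n : ℤ) : posPart f n ≤ 1 := by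
  unfold posPart; split_ifs; exacts [hf n, zero_le_one]

/-- The odd solution of the heat equation on `ℤ` with initial values `f` on the positive
integers. -/
lemma exists_odd_isHeatSol {c : ℝ} (hc : 0 ≤ c) {f : ℤ → ℝ} (hf0 : ∀ n, 0 ≤ f n)
    (hf1 : ∀ n, f n ≤ 1) :
    ∃ A : ℤ → ℝ → ℝ, IsHeatSol c stepInt A ∧ LocBdd A ∧ (∀ t, A 0 t = 0) ∧
      (∀ n, 0 < n → A n 0 = f n) ∧ ∀ n t, 0 ≤ t → A n t =
        (∑' m, walkKernel (c * t) (n - m) * posPart f m) -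
        ∑' m, walkKernel (c * t) (-n - m) * posPart f m := by
  have hB : ∀ n, |posPart f n| ≤ 1 := fun n => by
    rw [abs_of_nonneg (posPart_nonneg hf0 n)]; exact posPart_le_one hf1 n
  obtain ⟨u, hu, hub, hu0⟩ := exists_isHeatSol c stepInt (posPart f) hB
  -- Method of images; since `posPart f` lives on the positive integers, the image does not disturb
  -- the initial values there.
  refine ⟨fun n t => u n t - u (-n) t, hu.sub hu.comp_neg, hub.sub (hub.comp _), by simp, ?_, ?_⟩
  · intro n hn
    simp [hu0, posPart, hn, hn.le]
  · intro n t ht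
    have h := fun m => (hu.hasSum_walkKernel hc hub (fun x => by rw [hu0]; exact hB x) m ht).tsum_eq
    simp only [hu0] at h
    simp only [h]

/-- The antisymmetric solution on `ℤ⁴` with initial values `f` on the Weyl chamber. -/
lemma exists_alternating_isHeatSol {c : ℝ} (hc : 0 ≤ c) {f : (Fin 4 → ℤ) → ℝ}
    (hf0 : ∀ x, 0 ≤ f x) (hf1 : ∀ x, f x ≤ 1) :
    ∃ V : (Fin 4 → ℤ) → ℝ → ℝ, IsHeatSol c stepVec V ∧ LocBdd V ∧
      (∀ x t i j, i ≠ j → x i = x j → V x t = 0) ∧ (∀ x, StrictMono x → V x 0 = f x) ∧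
      ∀ x t, 0 ≤ t → V x t = ∑ σ : Equiv.Perm (Fin 4), (Equiv.Perm.sign σ : ℝ) *
        ∑' q, (∏ i, walkKernel (c * t) (x (σ i) - ends q i)) *
          {y | StrictMono y}.indicator f (ends q) := by
  classical
  have hB : ∀ x, |{y | StrictMono y}.indicator f x| ≤ 1 := fun x => by
    rw [abs_of_nonneg (indicator_nonneg (fun _ _ => hf0 _) _)]
    exact indicator_le' (fun _ _ => hf1 _) (fun _ _ => zero_le_one) x
  obtain ⟨u, hu, hub, hu0⟩ := exists_isHeatSol c stepVec _ hB
  refine ⟨fun x t => ∑ σ : Equiv.Perm (Fin 4), (Equiv.Perm.sign σ : ℝ) * u (x ∘ σ) t,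
    .sum _ fun σ _ => (hu.comp_perm σ).const_mul _, .sum _ fun σ _ => ?_, ?_, ?_, ?_⟩
  · exact (LocBdd.of_le (u := fun _ _ => _) fun _ _ _ => le_rfl).mul (hub.comp _)
  · intro x t i j hij hx
    -- Composing every permutation with the transposition leaves `x ∘ σ` unchanged when `x i = x j`
    -- but flips the sign, so the sum equals its own negative.
    have h := Equiv.sum_comp (Equiv.mulLeft (Equiv.swap i j))
      fun σ : Equiv.Perm (Fin 4) => (Equiv.Perm.sign σ : ℝ) * u (x ∘ σ) t
    have hsw : x ∘ Equiv.swap i j = x := by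
      ext k
      simp only [Function.comp_apply, Equiv.swap_apply_def]
      split_ifs with h1 h2
      · rw [h1, hx]
      · rw [h2, hx]
      · rfl
    simp only [Equiv.coe_mulLeft, Equiv.Perm.sign_mul, Equiv.Perm.sign_swap hij,
      Equiv.Perm.coe_mul, ← Function.comp_assoc, hsw] at h
    simp only [neg_mul, one_mul, Units.val_neg, Int.cast_neg, Finset.sum_neg_distrib] at h
    linarith
  · intro x hx
    dsimp only
    -- Two strictly monotone tuples with the same range coincide, so among the rearrangements of `x`
    -- only `x` itself lies in the chamber.
    rw [Finset.sum_eq_single_of_mem (1 : Equiv.Perm (Fin 4)) (Finset.mem_univ _)]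
    · simp [hu0, hx]
    · intro σ _ hσ
      rw [hu0, indicator_of_notMem, mul_zero]
      intro hm
      refine hσ (Equiv.ext fun i => hx.injective ?_)
      exact congrFun ((StrictMono.range_inj hm hx).1 (σ.surjective.range_comp x)) i
  · intro x t ht
    refine Finset.sum_congr rfl fun σ _ => ?_
    have h := (hu.hasSum_prod_walkKernel hc hub (fun x => by rw [hu0]; exact hB x)
      (x ∘ σ) ht).tsum_eq
    simp only [hu0, Function.comp_apply] at h
    rw [h]

/-! ### The Pfaffian solution -/

/-- The difference of two independent walks of rate `c` is a walk of rate `2 c`. -/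
lemma isHeatSol_diff {c : ℝ} {a : ℤ → ℝ → ℝ} (ha : IsHeatSol (2 * c) stepInt a) :
    IsHeatSol c stepVec fun (x : Fin 2 → ℤ) t => a (x 1 - x 0) t := by
  rw [isHeatSol_stepInt] at ha
  rw [isHeatSol_stepVec]
  intro x t ht
  refine (ha _ t ht).congr_deriv ?_
  have hs := fun p q => (sub_step p q)
  simp [hs]
  ring

lemma isHeatSol_diff_mul_diff {c : ℝ} {a b : ℤ → ℝ → ℝ} (ha : IsHeatSol (2 * c) stepInt a)
    (hb : IsHeatSol (2 * c) stepInt b) :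
    IsHeatSol c stepVec fun (x : Fin 4 → ℤ) t => a (x 1 - x 0) t * b (x 3 - x 2) t := by
  rw [isHeatSol_stepInt] at ha hb
  rw [isHeatSol_stepVec]
  intro x t ht
  refine ((ha _ t ht).mul (hb _ t ht)).congr_deriv ?_
  have hs := fun p q => (sub_step p q)
  simp [Fin.sum_univ_four, Function.update_apply, hs]
  ring

/-- The bilinear form whose diagonal is the Pfaffian of the matrix `a (x j - x i)`. -/
def pfaff (a b : ℤ → ℝ → ℝ) (x : Fin 4 → ℤ) (t : ℝ) : ℝ :=
  a (x 1 - x 0) t * b (x 3 - x 2) t - a (x 2 - x 0) t * b (x 3 - x 1) t +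
    a (x 3 - x 0) t * b (x 2 - x 1) t

/-- Each term is a product of functions of differences over disjoint pairs of coordinates, so all
three arise from the first by permuting coordinates. -/
lemma isHeatSol_pfaff {c : ℝ} {a b : ℤ → ℝ → ℝ} (ha : IsHeatSol (2 * c) stepInt a)
    (hb : IsHeatSol (2 * c) stepInt b) : IsHeatSol c stepVec (pfaff a b) := by
  have h := isHeatSol_diff_mul_diff ha hb
  have h1 := h.comp_perm (Equiv.swap 1 2)
  have h3 := h.comp_perm (Equiv.swap 1 3 * Equiv.swap 2 3)
  have e0 : (Equiv.swap 1 2 : Equiv.Perm (Fin 4)) 0 = 0 := by decide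
  have e3 : (Equiv.swap 1 2 : Equiv.Perm (Fin 4)) 3 = 3 := by decide
  have f0 : (Equiv.swap 1 3 * Equiv.swap 2 3 : Equiv.Perm (Fin 4)) 0 = 0 := by decide
  have f1 : (Equiv.swap 1 3 * Equiv.swap 2 3 : Equiv.Perm (Fin 4)) 1 = 3 := by decide
  have f2 : (Equiv.swap 1 3 * Equiv.swap 2 3 : Equiv.Perm (Fin 4)) 2 = 1 := by decide
  have f3 : (Equiv.swap 1 3 * Equiv.swap 2 3 : Equiv.Perm (Fin 4)) 3 = 2 := by decide
  have := (h.sub h1).add h3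
  simp only [Function.comp_apply, e0, e3, f0, f1, f2, f3, Equiv.swap_apply_left,
    Equiv.swap_apply_right] at this
  intro x t ht
  exact this x t ht

lemma LocBdd.pfaff {a b : ℤ → ℝ → ℝ} (ha : LocBdd a) (hb : LocBdd b) : LocBdd (pfaff a b) :=
  (((ha.comp fun x : Fin 4 → ℤ => x 1 - x 0).mul (hb.comp fun x : Fin 4 → ℤ => x 3 - x 2)).sub
    ((ha.comp fun x : Fin 4 → ℤ => x 2 - x 0).mul (hb.comp fun x : Fin 4 → ℤ => x 3 - x 1))).add
    ((ha.comp fun x : Fin 4 → ℤ => x 3 - x 0).mul (hb.comp fun x : Fin 4 → ℤ => x 2 - x 1))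

/-! ### The exact solution on the lattice -/

/-- Uniqueness for the heat equation on `Ω` with zero boundary values. -/
lemma eq_zero_of_heat_of_boundary {I J : Type*} [Fintype J] {c : ℝ} {ν : J → I → I}
    (hc : 0 ≤ c) (Ω : Set I) {w : I → ℝ → ℝ} (hb : LocBdd w)
    (hw : ∀ x ∈ Ω, ∀ t, 0 ≤ t →
      HasDerivWithinAt (w x) (c * ∑ j, (w (ν j x) t - w x t)) (Ici 0) t)
    (h0 : ∀ x ∈ Ω, w x 0 = 0) (hbd : ∀ x ∈ Ω, ∀ j, ν j x ∉ Ω → ∀ t, 0 ≤ t → w (ν j x) t = 0)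
    {x : I} (hx : x ∈ Ω) {t : ℝ} (ht : 0 ≤ t) : w x t = 0 := by
  classical
  -- Cutting `w` off outside `Ω` does not change the equation inside: a single jump out of `Ω` lands
  -- where `w` vanishes anyway.
  have h := eq_zero_of_heat_on (ν := ν) hc Ω (u := fun x t => if x ∈ Ω then w x t else 0)
    (hb.ite _) ?_ ?_ ?_ x ht
  · simpa [hx] using h
  · intro x hx t ht
    have hval : ∀ j, (if ν j x ∈ Ω then w (ν j x) t else 0) = w (ν j x) t := by
      intro j
      split_ifs with hj
      · rfl
      · rw [hbd x hx j hj t ht]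
    simpa only [hval, hx, if_true] using hw x hx t ht
  · intro x
    by_cases hx : x ∈ Ω
    · simp [hx, h0 x hx]
    · simp [hx]
  · intro x hx t
    simp [hx]

lemma IsLaw.abs_emptyProb_le {Γ : ℝ} {μ : ℝ → Measure Config} (hμ : IsLaw Γ μ) (S : Finset ℤ)
    {t : ℝ} (ht : 0 ≤ t) : |emptyProb (μ t) S| ≤ 1 := by
  have := hμ.isProbabilityMeasure t ht
  unfold emptyProb
  rw [abs_of_nonneg measureReal_nonneg]
  exact measureReal_le_one

/-- The one-interval probabilities of a law that is initially translation invariant. -/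
lemma IsLaw.emptyProb_block {Γ : ℝ} (hΓ : 0 ≤ Γ) {μ : ℝ → Measure Config} (hμ : IsLaw Γ μ)
    {e : ℤ → ℝ → ℝ} (he : IsHeatSol (2 * Γ) stepInt e) (heb : LocBdd e) (he0 : ∀ t, e 0 t = 1)
    (hinit : ∀ x : Fin 2 → ℤ, x 0 < x 1 → emptyProb (μ 0) (block x) = e (x 1 - x 0) 0)
    {x : Fin 2 → ℤ} (hx : x 0 ≤ x 1) {t : ℝ} (ht : 0 ≤ t) :
    emptyProb (μ t) (block x) = e (x 1 - x 0) t := by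
  classical
  have hwall : ∀ t, 0 ≤ t → ∀ y : Fin 2 → ℤ, y 0 = y 1 →
      emptyProb (μ t) (block y) = e (y 1 - y 0) t := by
    intro t ht y hy
    have := hμ.isProbabilityMeasure t ht
    simp [block, hy, he0, emptyProb]
  let w : (Fin 2 → ℤ) → ℝ → ℝ := fun x t => emptyProb (μ t) (block x) - e (x 1 - x 0) t
  have hwd : ∀ x : Fin 2 → ℤ, x 0 < x 1 → ∀ t, 0 ≤ t →
      HasDerivWithinAt (w x) (Γ * ∑ j, (w (stepVec j x) t - w x t)) (Ici 0) t := by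
    intro x hx t ht
    refine ((hμ.hasDerivWithinAt_block hx ht).sub (isHeatSol_diff he x t ht)).congr_deriv ?_
    rw [← mul_sub, ← Finset.sum_sub_distrib]
    exact congrArg _ (Finset.sum_congr rfl fun j _ => by simp only [w]; ring)
  have hwb : LocBdd w :=
    (LocBdd.of_le (u := fun (x : Fin 2 → ℤ) t => emptyProb (μ t) (block x))
      fun x t ht => hμ.abs_emptyProb_le _ ht).sub (heb.comp fun x : Fin 2 → ℤ => x 1 - x 0)
  rcases hx.lt_or_eq with h1 | h1
  · refine sub_eq_zero.1 (eq_zero_of_heat_of_boundary hΓ {x : Fin 2 → ℤ | x 0 < x 1} hwb hwd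
      (fun y hy => sub_eq_zero.2 (hinit y hy)) ?_ h1 ht)
    intro y hy j hj t ht
    refine sub_eq_zero.2 (hwall t ht _ ?_)
    have hy' : y 0 < y 1 := hy
    have hj' : ¬stepVec j y 0 < stepVec j y 1 := hj
    obtain ⟨k, b⟩ := j
    fin_cases k <;> cases b <;> simp [stepVec, stepInt] at hj' ⊢ <;> omega
  · exact hwall t ht x h1

/-- The two-interval probabilities, in terms of solutions `p`, `h` of the one-interval equation
and an antisymmetric solution `V` on `ℤ⁴`. -/
lemma IsLaw.emptyProb_blocks {Γ : ℝ} (hΓ : 0 ≤ Γ) {μ : ℝ → Measure Config} (hμ : IsLaw Γ μ)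
    {p h : ℤ → ℝ → ℝ} (hp : IsHeatSol (2 * Γ) stepInt p) (hpb : LocBdd p)
    (hp0 : ∀ t, p 0 t = 1) (hpi : ∀ n, 0 < n → p n 0 = 0)
    (hh : IsHeatSol (2 * Γ) stepInt h) (hhb : LocBdd h) (hh0 : ∀ t, h 0 t = 0)
    (hblock : ∀ (x : Fin 2 → ℤ) t, x 0 ≤ x 1 → 0 ≤ t →
      emptyProb (μ t) (block x) = p (x 1 - x 0) t + h (x 1 - x 0) t)
    {V : (Fin 4 → ℤ) → ℝ → ℝ} (hV : IsHeatSol Γ stepVec V) (hVb : LocBdd V)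
    (hV0 : ∀ x t i j, i ≠ j → x i = x j → V x t = 0)
    (hVi : ∀ x, StrictMono x → V x 0 = emptyProb (μ 0) (blocks x))
    {x : Fin 4 → ℤ} (h0 : x 0 ≤ x 1) (h1 : x 1 ≤ x 2) (h2 : x 2 ≤ x 3) {t : ℝ} (ht : 0 ≤ t) :
    emptyProb (μ t) (blocks x) = pfaff p p x t + pfaff p h x t + pfaff h p x t + V x t := by
  let w : (Fin 4 → ℤ) → ℝ → ℝ := fun x t =>
    emptyProb (μ t) (blocks x) - (pfaff p p x t + pfaff p h x t + pfaff h p x t + V x t)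
  -- On each wall the Pfaffian terms cancel in pairs, apart from those with a factor `p 0 = 1`.
  -- These leave `p + h` at the length of the interval that remains.
  have hwall : ∀ t, 0 ≤ t → ∀ y : Fin 4 → ℤ, y 0 ≤ y 1 → y 1 ≤ y 2 → y 2 ≤ y 3 →
      ¬(y 0 < y 1 ∧ y 1 < y 2 ∧ y 2 < y 3) → w y t = 0 := by
    intro t ht y h0 h1 h2 hy
    have : y 0 = y 1 ∨ y 1 = y 2 ∨ y 2 = y 3 := by omega
    rcases this with h | h | h
    · have hb : blocks y = block ![y 2, y 3] := by simp [blocks, block, h]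
      have := hblock ![y 2, y 3] t h2 ht
      simp only [w, hb, this, pfaff, hV0 y t 0 1 (by decide) h, Matrix.cons_val, h, sub_self, hp0,
        hh0]
      ring
    · have hb : blocks y = block ![y 0, y 3] := by
        simp only [blocks, block, Matrix.cons_val, ← h]
        exact Finset.Ico_union_Ico_eq_Ico h0 (h.le.trans h2)
      have := hblock ![y 0, y 3] t (h0.trans (h1.trans h2)) ht
      simp only [w, hb, this, pfaff, hV0 y t 1 2 (by decide) h, Matrix.cons_val, h, sub_self, hp0,
        hh0]
      ring
    · have hb : blocks y = block ![y 0, y 1] := by simp [blocks, block, h]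
      have := hblock ![y 0, y 1] t h0 ht
      simp only [w, hb, this, pfaff, hV0 y t 2 3 (by decide) h, Matrix.cons_val, h, sub_self, hp0,
        hh0]
      ring
  have hP : IsHeatSol Γ stepVec fun x t =>
      pfaff p p x t + pfaff p h x t + pfaff h p x t + V x t :=
    (((isHeatSol_pfaff hp hp).add (isHeatSol_pfaff hp hh)).add (isHeatSol_pfaff hh hp)).add hV
  have hwb : LocBdd w := (LocBdd.of_le (u := fun (x : Fin 4 → ℤ) t => emptyProb (μ t) (blocks x))
      fun x t ht => hμ.abs_emptyProb_le _ ht).sub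
    ((((hpb.pfaff hpb).add (hpb.pfaff hhb)).add (hhb.pfaff hpb)).add hVb)
  by_cases hx : x 0 < x 1 ∧ x 1 < x 2 ∧ x 2 < x 3
  · refine sub_eq_zero.1 (eq_zero_of_heat_of_boundary (ν := stepVec) (w := w) hΓ
      {x : Fin 4 → ℤ | x 0 < x 1 ∧ x 1 < x 2 ∧ x 2 < x 3} hwb ?_ ?_ ?_ hx ht)
    · intro y hy t ht
      refine ((hμ.hasDerivWithinAt_blocks hy.1 hy.2.1 hy.2.2 ht).sub (hP y t ht)).congr_deriv ?_
      rw [← mul_sub, ← Finset.sum_sub_distrib]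
      exact congrArg _ (Finset.sum_congr rfl fun j _ => by simp only [w]; ring)
    · intro y hy
      have hmono : StrictMono y := by
        refine Fin.strictMono_iff_lt_succ.2 fun i => ?_
        fin_cases i
        exacts [hy.1, hy.2.1, hy.2.2]
      -- Every Pfaffian term has a factor `p` at a positive argument, so initially only `V`
      -- contributes.
      have hpos : ∀ i j, i < j → p (y j - y i) 0 = 0 := fun i j hij =>
        hpi _ (sub_pos.2 (hmono hij))
      simp only [w, hVi y hmono, pfaff, hpos 0 1 (by decide), hpos 2 3 (by decide),
        hpos 0 2 (by decide), hpos 1 3 (by decide), hpos 0 3 (by decide), hpos 1 2 (by decide)]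
      ring
    · intro y hy j hj t ht
      have hy' : y 0 < y 1 ∧ y 1 < y 2 ∧ y 2 < y 3 := hy
      refine hwall t ht _ ?_ ?_ ?_ hj
      all_goals
        obtain ⟨k, b⟩ := j
        fin_cases k <;> cases b <;> simp [stepVec, stepInt] <;> omega
  · exact sub_eq_zero.1 (hwall t ht x h0 h1 h2 hx)

/-! ### Translation invariance of the initial law -/

lemma IsTranslationInvariant.emptyProb_add {ν : Measure Config} (hν : IsTranslationInvariant ν)
    (S : Finset ℤ) (m : ℤ) : emptyProb ν (S.image (· + m)) = emptyProb ν S := by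
  have h1 : ∀ S : Finset ℤ, emptyProb ν (S.image (· + 1)) = emptyProb ν S := by
    intro S
    have hm : Measurable fun (η : Config) (i : ℤ) => η (i + 1) :=
      measurable_pi_lambda _ fun i => measurable_pi_apply _
    conv_rhs => rw [emptyProb, ← hν, map_measureReal_apply hm (measurableSet_empty S)]
    unfold emptyProb
    congr 1
    ext η
    simp only [mem_ofPred_eq, mem_preimage, Finset.forall_mem_image]
  have h2 : ∀ (n : ℕ) (S : Finset ℤ), emptyProb ν (S.image (· + (n : ℤ))) = emptyProb ν S := by
    intro n
    induction n with
    | zero => intro S; simp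
    | succ n ih =>
      intro S
      have h := (h1 (S.image (· + (n : ℤ)))).trans (ih S)
      rw [Finset.image_image] at h
      simpa only [Function.comp_def, Nat.cast_succ, add_assoc] using h
  rcases Int.eq_nat_or_neg m with ⟨n, rfl | rfl⟩
  · exact h2 n S
  · rw [← h2 n, Finset.image_image]
    congr 1
    ext i
    simp

lemma IsTranslationInvariant.emptyProb_block {ν : Measure Config} (hν : IsTranslationInvariant ν)
    {x : Fin 2 → ℤ} (hx : x 0 ≤ x 1) :
    emptyProb ν (block x) = oneInterval ν (x 1 - x 0).toNat := by
  rw [oneInterval, ← hν.emptyProb_add (Finset.Ico _ _) (x 0), Finset.image_add_right_Ico]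
  congr 1
  ext i
  simp only [block, Finset.mem_Ico]
  omega

lemma IsTranslationInvariant.emptyProb_blocks {ν : Measure Config}
    (hν : IsTranslationInvariant ν) {x : Fin 4 → ℤ} (h0 : x 0 ≤ x 1) (h1 : x 1 ≤ x 2)
    (h2 : x 2 ≤ x 3) : emptyProb ν (blocks x) =
      twoInterval ν (x 1 - x 0).toNat (x 3 - x 2).toNat (x 2 - x 1).toNat := by
  rw [twoInterval, ← hν.emptyProb_add (Finset.Ico _ _ ∪ _) (x 0), Finset.image_union, Finset.image_add_right_Ico,
    Finset.image_add_right_Ico]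
  congr 1
  ext i
  simp only [blocks, Finset.mem_Ico, Finset.mem_union]
  omega

lemma twoInterval_eq_emptyProb_blocks (ν : Measure Config) (n₁ n₂ d : ℕ) :
    twoInterval ν n₁ n₂ d =
      emptyProb ν (blocks ![0, (n₁ : ℤ), (n₁ : ℤ) + d, (n₁ : ℤ) + d + n₂]) := by
  simp [twoInterval, blocks]

/-! ### The Gaussian integral over the position of a pair of intervals -/

/-- The determinant behind the kernel `K₂`. -/
lemma sum_sign_exp_eq_K₂ (x' y' z' x y z : ℝ) :
    ∑ σ : Equiv.Perm (Fin 4), (Equiv.Perm.sign σ : ℝ) * Real.exp (4 * ∑ i,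
      ![0, x, x + z, x + z + y] (σ i) * ![-z' - x', -z', 0, y'] i) =
    Real.exp (4 * ∑ i, ![0, x, x + z, x + z + y] i * ![-z' - x', -z', 0, y'] i) *
      K₂ x' y' z' x y z := by
  -- The signed sum is the Leibniz formula for the determinant of `exp (4 ξᵢ ηⱼ)`, whose row `ξ = 0`
  -- and column `η = 0` consist of ones.
  have hdet := Matrix.det_apply' (Matrix.of fun i j : Fin 4 => Real.exp (4 *
    (![0, x, x + z, x + z + y] i * ![-z' - x', -z', 0, y'] j)))
  simp only [Matrix.of_apply, ← Real.exp_sum, ← Finset.mul_sum] at hdet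
  rw [← hdet, Matrix.det_succ_row_zero]
  simp only [Fin.sum_univ_four, Matrix.det_fin_three, Matrix.submatrix_apply, Matrix.of_apply]
  simp [Fin.succAbove, K₂]
  simp only [mul_sub, sub_mul, mul_add, add_mul, ← Real.exp_add, mul_one, one_mul]
  ring_nf

/-- Completing the square in `u` around the mean of the `δ i` separates the common translation from
the relative positions. -/
lemma prod_heatDensity_shift {κ : ℝ} (hκ : 0 < κ) (δ : Fin 4 → ℝ) (u : ℝ) :
    ∏ i, heatDensity κ (δ i - u) = (√(4 * Real.pi * κ))⁻¹ ^ 4 *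
      Real.exp (-(4 * κ)⁻¹ * (∑ i, δ i ^ 2 - (∑ i, δ i) ^ 2 / 4)) *
        Real.exp (-κ⁻¹ * (u - (∑ i, δ i) / 4) ^ 2) := by
  simp only [heatDensity_eq, Finset.prod_mul_distrib, Finset.prod_const, Finset.card_univ,
    Fintype.card_fin, ← Real.exp_sum, mul_assoc, ← Real.exp_add]
  congr 2
  simp only [Fin.sum_univ_four]
  have := hκ.ne'
  field_simp
  ring

lemma integrable_prod_heatDensity_shift {κ : ℝ} (hκ : 0 < κ) (δ : Fin 4 → ℝ) :
    Integrable fun u => ∏ i, heatDensity κ (δ i - u) := by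
  simp only [prod_heatDensity_shift hκ]
  exact ((integrable_exp_neg_mul_sq (inv_pos.2 hκ)).comp_sub_right _).const_mul _

lemma integral_prod_heatDensity_shift {κ : ℝ} (hκ : 0 < κ) (δ : Fin 4 → ℝ) :
    ∫ u, ∏ i, heatDensity κ (δ i - u) = (√(4 * Real.pi * κ))⁻¹ ^ 4 * √(Real.pi * κ) *
      Real.exp (-(4 * κ)⁻¹ * (∑ i, δ i ^ 2 - (∑ i, δ i) ^ 2 / 4)) := by
  simp only [prod_heatDensity_shift hκ]
  rw [integral_const_mul, integral_sub_right_eq_self fun u => Real.exp (-κ⁻¹ * u ^ 2),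
    integral_gaussian, div_inv_eq_mul]
  ring

lemma ends_sub_eq (ξ : Fin 4 → ℝ) (p : ℝ × ℝ × ℝ) (u : ℝ) (i j : Fin 4) :
    ξ i - ends (p, u) j = (ξ i - ![-p.2.2 - p.1, -p.2.2, 0, p.2.1] j) - u := by
  fin_cases j <;> simp [ends] <;> ring

/-- The transition density of four annihilating walkers, before integration over the position
of the initial pair of intervals. -/
def chamberDensity (κ : ℝ) (ξ : Fin 4 → ℝ) (q : (ℝ × ℝ × ℝ) × ℝ) : ℝ :=
  ∑ σ : Equiv.Perm (Fin 4), (Equiv.Perm.sign σ : ℝ) * ∏ i, heatDensity κ (ξ (σ i) - ends q i)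

/-- After the Gaussian integral over `u`, a permutation enters only through the scalar product of `ξ
∘ σ` with the initial endpoints, so the signed sum is the determinant `sum_sign_exp_eq_K₂`. -/
lemma integral_chamberDensity {κ : ℝ} (hκ : 0 < κ) (x y z : ℝ) (p : ℝ × ℝ × ℝ) :
    ∫ u, chamberDensity κ ![0, x, x + z, x + z + y] (p, u) =
      √2 / (√(8 * κ) ^ 3 * √Real.pi ^ 3) *
        (gaussKernel ((x - p.1) / √(8 * κ)) ((y - p.2.1) / √(8 * κ)) ((z - p.2.2) / √(8 * κ)) *
        K₂ (p.1 / √(8 * κ)) (p.2.1 / √(8 * κ)) (p.2.2 / √(8 * κ)) (x / √(8 * κ)) (y / √(8 * κ))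
          (z / √(8 * κ))) := by
  obtain ⟨x', y', z'⟩ := p
  set ξ : Fin 4 → ℝ := ![0, x, x + z, x + z + y] with hξ
  set η : Fin 4 → ℝ := ![-z' - x', -z', 0, y'] with hη
  set L : ℝ := (√(8 * κ))⁻¹ with hL
  have hL2 : (4 * κ)⁻¹ = 2 * L ^ 2 := by
    rw [hL, inv_pow, Real.sq_sqrt (by positivity)]
    field_simp
    norm_num
  -- Sums and sums of squares of `ξ ∘ σ` do not depend on `σ`.
  have hsum : ∀ σ : Equiv.Perm (Fin 4), -(4 * κ)⁻¹ * (∑ i, (ξ (σ i) - η i) ^ 2 -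
      (∑ i, (ξ (σ i) - η i)) ^ 2 / 4) = -(2 * L ^ 2) * (∑ i, ξ i ^ 2 + ∑ i, η i ^ 2 -
        (∑ i, ξ i - ∑ i, η i) ^ 2 / 4) + 4 * L ^ 2 * ∑ i, ξ (σ i) * η i := by
    intro σ
    have h1 : ∑ i, (ξ (σ i) - η i) = ∑ i, ξ i - ∑ i, η i := by
      rw [Finset.sum_sub_distrib, Equiv.sum_comp σ]
    have h2 : ∑ i, (ξ (σ i) - η i) ^ 2 = ∑ i, ξ i ^ 2 + ∑ i, η i ^ 2 -
        2 * ∑ i, ξ (σ i) * η i := by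
      rw [← Equiv.sum_comp σ fun i => ξ i ^ 2, ← Finset.sum_add_distrib, Finset.mul_sum,
        ← Finset.sum_sub_distrib]
      exact Finset.sum_congr rfl fun i _ => by ring
    rw [h1, h2, hL2]
    ring
  have hscale : ∀ σ : Equiv.Perm (Fin 4), 4 * L ^ 2 * ∑ i, ξ (σ i) * η i = 4 * ∑ i,
      ![0, x * L, x * L + z * L, x * L + z * L + y * L] (σ i) *
        ![-(z' * L) - x' * L, -(z' * L), 0, y' * L] i := by
    intro σ
    have h1 : ∀ i, ![0, x * L, x * L + z * L, x * L + z * L + y * L] i = L * ξ i := by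
      intro i
      fin_cases i <;> simp [hξ] <;> ring
    have h2 : ∀ i, ![-(z' * L) - x' * L, -(z' * L), 0, y' * L] i = L * η i := by
      intro i
      fin_cases i <;> simp [hη] <;> ring
    simp only [h1, h2, Finset.mul_sum]
    exact Finset.sum_congr rfl fun i _ => by ring
  have hconst : (√(4 * Real.pi * κ))⁻¹ ^ 4 * √(Real.pi * κ) =
      √2 / (√(8 * κ) ^ 3 * √Real.pi ^ 3) := by
    have hpi := Real.pi_pos
    have h8 : √(8 * κ) = 2 * √2 * √κ := by
      rw [show (8 : ℝ) * κ = 2 ^ 2 * 2 * κ by norm_num, Real.sqrt_mul (by positivity),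
        Real.sqrt_mul (by positivity), Real.sqrt_sq (by norm_num)]
    have h4 : √(4 * Real.pi * κ) = 2 * √Real.pi * √κ := by
      rw [show (4 : ℝ) * Real.pi * κ = 2 ^ 2 * Real.pi * κ by norm_num,
        Real.sqrt_mul (by positivity), Real.sqrt_mul (by positivity), Real.sqrt_sq (by norm_num)]
    have h2 : √(2 : ℝ) ^ 2 = 2 := Real.sq_sqrt (by norm_num)
    have h2' : √(2 : ℝ) ≠ 0 := by positivity
    have hp : √Real.pi ≠ 0 := by positivity
    have hk : √κ ≠ 0 := by positivity
    rw [h8, h4, Real.sqrt_mul hpi.le]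
    field_simp
    linear_combination h2
  have hdens : ∀ u, chamberDensity κ ξ ((x', y', z'), u) =
      ∑ σ : Equiv.Perm (Fin 4), (Equiv.Perm.sign σ : ℝ) *
        ∏ i, heatDensity κ ((ξ (σ i) - η i) - u) := by
    intro u
    simp only [chamberDensity, ends_sub_eq]
    rfl
  simp only [hdens]
  rw [integral_finsetSum _ fun σ _ =>
    (integrable_prod_heatDensity_shift hκ fun i => ξ (σ i) - η i).const_mul _]
  have hI : ∀ σ : Equiv.Perm (Fin 4), ∫ u, ∏ i, heatDensity κ ((ξ (σ i) - η i) - u) =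
      √2 / (√(8 * κ) ^ 3 * √Real.pi ^ 3) * Real.exp (-(2 * L ^ 2) * (∑ i, ξ i ^ 2 +
        ∑ i, η i ^ 2 - (∑ i, ξ i - ∑ i, η i) ^ 2 / 4)) * Real.exp (4 * ∑ i,
      ![0, x * L, x * L + z * L, x * L + z * L + y * L] (σ i) *
        ![-(z' * L) - x' * L, -(z' * L), 0, y' * L] i) := by
    intro σ
    rw [integral_prod_heatDensity_shift hκ fun i => ξ (σ i) - η i, hsum, hconst, Real.exp_add,
      hscale, mul_assoc]
  simp only [integral_const_mul, hI, mul_left_comm ((Equiv.Perm.sign _ : ℤ) : ℝ)]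
  -- The exponential of the identity permutation, split off in front of `K₂`, joins the
  -- permutation-independent Gaussian to form `𝒲`.
  rw [← Finset.mul_sum, sum_sign_exp_eq_K₂, mul_assoc, ← mul_assoc (Real.exp _), ← Real.exp_add]
  simp only [div_eq_mul_inv _ √(8 * κ), ← hL, gaussKernel]
  congr 3
  simp only [Fin.sum_univ_four, hξ, hη, Matrix.cons_val]
  ring

/-! ### Continuum limits -/

/-- The difference of a convolution with the Gaussian and its mirror image, for initial values
`f` on the positive half-line. -/
def oddConv (κ : ℝ) (f : ℝ → ℝ) (ξ : ℝ) : ℝ :=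
  (∫ v, heatDensity κ (ξ - v) * (Ioi 0).indicator f v) -
    ∫ v, heatDensity κ (-ξ - v) * (Ioi 0).indicator f v

lemma heatDensity_neg (κ ξ : ℝ) : heatDensity κ (-ξ) = heatDensity κ ξ := by
  simp [heatDensity]

lemma heatDensity_eq_scaled (κ : ℝ) (hκ : 0 ≤ κ) (ξ : ℝ) :
    heatDensity κ ξ = 1 / (√(4 * κ) * √Real.pi) * Real.exp (-(ξ / √(4 * κ)) ^ 2) := by
  rw [heatDensity, div_pow, Real.sq_sqrt (by positivity), ← Real.sqrt_mul (by positivity),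
    one_div, neg_div]
  congr 3
  ring

lemma setIntegral_Ioi_heatDensity {κ : ℝ} (hκ : 0 < κ) (ξ : ℝ) :
    ∫ v in Ioi ξ, heatDensity κ v = erfc (ξ / √(4 * κ)) / 2 := by
  have hl : 0 < √(4 * κ) := by positivity
  have hpi : 0 < √Real.pi := by have := Real.pi_pos; positivity
  have h := integral_comp_mul_left_Ioi (fun s => Real.exp (-s ^ 2)) ξ (inv_pos.2 hl)
  simp only [heatDensity_eq_scaled κ hκ.le, integral_const_mul, erfc]
  simp only [div_eq_inv_mul _ (√(4 * κ))]
  rw [h, smul_eq_mul, inv_inv]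
  field_simp

/-- Erosion of the initial step profile. -/
lemma oddConv_one {κ : ℝ} (hκ : 0 < κ) (ξ : ℝ) :
    oddConv κ (fun _ => 1) ξ = 1 - erfc (ξ / √(4 * κ)) := by
  -- The convolution with a step is a Gaussian tail; the two tails at `ξ` and `-ξ` are complementary
  -- by symmetry.
  have h : ∀ c : ℝ, ∫ v, heatDensity κ (c - v) * (Ioi 0).indicator (fun _ => 1) v =
      ∫ w in Iio c, heatDensity κ w := by
    intro c
    rw [← integral_indicator measurableSet_Iio,
      ← integral_sub_left_eq_self ((Iio c).indicator (heatDensity κ)) volume c]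
    congr 1
    ext v
    by_cases hv : 0 < v <;> simp [hv]
  have hsymm : ∫ w in Iio (-ξ), heatDensity κ w = ∫ w in Ioi ξ, heatDensity κ w := by
    rw [← integral_Iic_eq_integral_Iio, ← integral_comp_neg_Ioi]
    simp only [heatDensity_neg]
  have htot := integral_add_compl (measurableSet_Ioi (a := ξ)) (integrable_heatDensity hκ)
  rw [compl_Ioi, integral_heatDensity hκ, integral_Iic_eq_integral_Iio] at htot
  rw [oddConv, h, h, hsymm]
  have := setIntegral_Ioi_heatDensity hκ ξ
  linarith

lemma tendsto_div_atTop_of_pos {a : ℕ → ℝ} (ha : ∀ k, 0 < a k) (ha0 : Tendsto a atTop (𝓝 0))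
    {v : ℝ} (hv : 0 < v) : Tendsto (fun k => v / a k) atTop atTop := by
  have h : Tendsto a atTop (𝓝[>] 0) :=
    tendsto_nhdsWithin_iff.2 ⟨ha0, Eventually.of_forall ha⟩
  simpa only [div_eq_mul_inv, Function.comp_apply] using (tendsto_inv_nhdsGT_zero.comp h).const_mul_atTop hv

lemma eventually_floor_div_pos {a : ℕ → ℝ} (ha : ∀ k, 0 < a k) (ha0 : Tendsto a atTop (𝓝 0))
    {v : ℝ} (hv : 0 < v) : ∀ᶠ k in atTop, 0 < ⌊v / a k⌋ := by
  filter_upwards [(tendsto_div_atTop_of_pos ha ha0 hv).eventually_ge_atTop 1] with k hk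
  exact Int.floor_pos.2 hk

lemma floor_div_nonpos {a v : ℝ} (ha : 0 < a) (hv : ¬0 < v) : ¬0 < ⌊v / a⌋ := by
  rw [Int.floor_pos]
  have : v / a ≤ 0 := div_nonpos_of_nonpos_of_nonneg (not_lt.1 hv) ha.le
  linarith

/-- Convergence of the initial one-interval profile. -/
lemma tendsto_posPart_floor {a : ℕ → ℝ} (ha : ∀ k, 0 < a k) (ha0 : Tendsto a atTop (𝓝 0))
    {e : ℕ → ℕ → ℝ} {E : ℝ → ℝ}
    (hE : ∀ v, 0 < v → Tendsto (fun k => e k ⌊v / a k⌋₊) atTop (𝓝 (E v))) (v : ℝ) :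
    Tendsto (fun k => posPart (fun n => e k n.toNat) ⌊v / a k⌋) atTop
      (𝓝 ((Ioi 0).indicator E v)) := by
  by_cases hv : 0 < v
  · rw [indicator_of_mem (mem_Ioi.2 hv)]
    refine (hE v hv).congr' ?_
    filter_upwards [eventually_floor_div_pos ha ha0 hv] with k hk
    rw [posPart, if_pos hk, Int.floor_toNat]
  · rw [indicator_of_notMem (by simpa using hv)]
    refine tendsto_const_nhds.congr fun k => ?_
    rw [posPart, if_neg (floor_div_nonpos (ha k) hv)]

/-- Continuum limit of the odd lattice solutions. -/
lemma tendsto_odd_solution {κ : ℝ} (hκ : 0 < κ) {a : ℕ → ℝ} (ha : ∀ k, 0 < a k)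
    (ha0 : Tendsto a atTop (𝓝 0)) {e : ℕ → ℕ → ℝ} (he0 : ∀ k n, 0 ≤ e k n)
    (he1 : ∀ k n, e k n ≤ 1) {E : ℝ → ℝ}
    (hE : ∀ v, 0 < v → Tendsto (fun k => e k ⌊v / a k⌋₊) atTop (𝓝 (E v)))
    {N : ℕ → ℤ} {ξ : ℝ} (hN : Tendsto (fun k => a k * N k) atTop (𝓝 ξ)) :
    Tendsto (fun k =>
      (∑' m, walkKernel (κ / a k ^ 2) (N k - m) * posPart (fun n => e k n.toNat) m) -
        ∑' m, walkKernel (κ / a k ^ 2) (-N k - m) * posPart (fun n => e k n.toNat) m) atTop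
      (𝓝 (oddConv κ E ξ)) := by
  have h := fun (M : ℕ → ℤ) (ζ : ℝ) (hM : Tendsto (fun k => a k * M k) atTop (𝓝 ζ)) =>
    tendsto_tsum_walkKernel hκ ha ha0 hM
      (fun k n => posPart_nonneg (f := fun n => e k n.toNat) (fun n => he0 k _) n)
      (fun k n => posPart_le_one (f := fun n => e k n.toNat) (fun n => he1 k _) n)
      (Eventually.of_forall (tendsto_posPart_floor ha ha0 hE))
  refine (h N ξ hN).sub (h (fun k => -N k) (-ξ) ?_)
  push_cast
  simpa only [mul_neg] using hN.neg

/-- The part of the integrand of `E⁽¹⁾` coming from one interval of length `ξ`. -/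
lemma integrableOn_and_oddConv_eq {κ : ℝ} (hκ : 0 < κ) {E : ℝ → ℝ}
    (hE : AEStronglyMeasurable ((Ioi (0 : ℝ)).indicator E)) (hE1 : ∀ v, 0 < v → |E v| ≤ 1)
    (ξ : ℝ) :
    IntegrableOn (fun v => E v * (Real.exp (-((v - ξ) / √(4 * κ)) ^ 2) -
      Real.exp (-((v + ξ) / √(4 * κ)) ^ 2))) (Ioi 0) ∧
    oddConv κ E ξ = 1 / (√(4 * κ) * √Real.pi) * ∫ v in Ioi 0, E v *
      (Real.exp (-((v - ξ) / √(4 * κ)) ^ 2) - Real.exp (-((v + ξ) / √(4 * κ)) ^ 2)) := by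
  have hl : 0 < √(4 * κ) := by positivity
  have hpi : 0 < √Real.pi := by have := Real.pi_pos; positivity
  have hb : ∀ v, ‖(Ioi (0 : ℝ)).indicator E v‖ ≤ 1 := by
    intro v
    by_cases hv : 0 < v
    · rw [indicator_of_mem (mem_Ioi.2 hv)]; exact hE1 v hv
    · rw [indicator_of_notMem (by simpa using hv), norm_zero]; exact zero_le_one
  have hint : ∀ c, Integrable fun v => heatDensity κ (c - v) * (Ioi 0).indicator E v := fun c =>
    ((integrable_heatDensity hκ).comp_sub_left c).mul_bdd hE (Eventually.of_forall hb)
  have heq : ∀ v, heatDensity κ (ξ - v) * (Ioi 0).indicator E v -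
      heatDensity κ (-ξ - v) * (Ioi 0).indicator E v = 1 / (√(4 * κ) * √Real.pi) *
      (Ioi 0).indicator (fun v => E v * (Real.exp (-((v - ξ) / √(4 * κ)) ^ 2) -
        Real.exp (-((v + ξ) / √(4 * κ)) ^ 2))) v := by
    intro v
    by_cases hv : 0 < v
    · rw [indicator_of_mem (mem_Ioi.2 hv), indicator_of_mem (mem_Ioi.2 hv),
        ← heatDensity_neg κ (ξ - v), ← heatDensity_neg κ (-ξ - v),
        heatDensity_eq_scaled κ hκ.le, heatDensity_eq_scaled κ hκ.le, neg_sub,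
        show -(-ξ - v) = v + ξ by ring]
      ring
    · rw [indicator_of_notMem (by simpa using hv), indicator_of_notMem (by simpa using hv)]
      ring
  have hsub := (hint ξ).sub (hint (-ξ))
  constructor
  · rw [← integrable_indicator_iff measurableSet_Ioi]
    have := hsub.const_mul (1 / (√(4 * κ) * √Real.pi))⁻¹
    refine this.congr (Eventually.of_forall fun v => ?_)
    simp only [Pi.sub_apply, heq]
    rw [inv_mul_cancel_left₀ (by positivity)]
  · rw [oddConv, ← integral_sub (hint ξ) (hint (-ξ))]
    simp only [heq]
    rw [integral_const_mul, integral_indicator measurableSet_Ioi]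

lemma diffLength_eq (D t : ℝ) : diffLength D t = √(4 * (2 * (D * t))) := by
  rw [diffLength]; congr 1; ring

/-- `K₁` consists of the six mixed terms `p h` and `h p` of the Pfaffian, with `erfc` the limit of
`p` and `oddConv` that of `h`. -/
lemma integrableOn_EoneIntegrand_and_Eone_eq {κ : ℝ} (hκ : 0 < κ) {E : ℝ → ℝ}
    (hE : AEStronglyMeasurable ((Ioi (0 : ℝ)).indicator E)) (hE1 : ∀ v, 0 < v → |E v| ≤ 1)
    (x y z : ℝ) :
    IntegrableOn (EoneIntegrand E √(4 * κ) x y z) (Ioi 0) ∧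
    Eone E √(4 * κ) x y z =
      erfc (z / √(4 * κ)) * oddConv κ E (x + y + z) + erfc (x / √(4 * κ)) * oddConv κ E y
      - erfc ((x + z) / √(4 * κ)) * oddConv κ E (y + z) + erfc (y / √(4 * κ)) * oddConv κ E x
      - erfc ((y + z) / √(4 * κ)) * oddConv κ E (x + z)
      + erfc ((x + y + z) / √(4 * κ)) * oddConv κ E z := by
  have h := integrableOn_and_oddConv_eq hκ hE hE1
  set l := √(4 * κ)
  set g : ℝ → ℝ → ℝ := fun ξ v => E v * (Real.exp (-((v - ξ) / l) ^ 2) -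
      Real.exp (-((v + ξ) / l) ^ 2))
  have hg : ∀ ξ, IntegrableOn (g ξ) (Ioi 0) := fun ξ => (h ξ).1
  have heq : EoneIntegrand E l x y z = fun v =>
      erfc (z / l) * g (x + y + z) v + erfc (x / l) * g y v - erfc ((x + z) / l) * g (y + z) v
        + erfc (y / l) * g x v - erfc ((y + z) / l) * g (x + z) v
        + erfc ((x + y + z) / l) * g z v := by
    ext v
    simp only [EoneIntegrand, K₁, g, ← add_div, ← sub_div, sub_sub, ← add_assoc]
    ring
  have i1 := (hg (x + y + z)).const_mul (erfc (z / l))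
  have i2 := i1.add ((hg y).const_mul (erfc (x / l)))
  have i3 := i2.sub ((hg (y + z)).const_mul (erfc ((x + z) / l)))
  have i4 := i3.add ((hg x).const_mul (erfc (y / l)))
  have i5 := i4.sub ((hg (x + z)).const_mul (erfc ((y + z) / l)))
  have i6 := i5.add ((hg z).const_mul (erfc ((x + y + z) / l)))
  refine ⟨heq ▸ i6, ?_⟩
  have hint : ∫ v in Ioi 0, EoneIntegrand E l x y z v =
      erfc (z / l) * (∫ v in Ioi 0, g (x + y + z) v) + erfc (x / l) * (∫ v in Ioi 0, g y v)
      - erfc ((x + z) / l) * (∫ v in Ioi 0, g (y + z) v) + erfc (y / l) * (∫ v in Ioi 0, g x v)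
      - erfc ((y + z) / l) * (∫ v in Ioi 0, g (x + z) v)
      + erfc ((x + y + z) / l) * (∫ v in Ioi 0, g z v) := by
    rw [heq]
    refine (integral_add i5 ((hg z).const_mul _)).trans ?_
    refine congrArg₂ _ ((integral_sub i4 ((hg (x + z)).const_mul _)).trans ?_)
      (integral_const_mul _ _)
    refine congrArg₂ _ ((integral_add i3 ((hg x).const_mul _)).trans ?_)
      (integral_const_mul _ _)
    refine congrArg₂ _ ((integral_sub i2 ((hg (y + z)).const_mul _)).trans ?_)
      (integral_const_mul _ _)
    refine congrArg₂ _ ((integral_add i1 ((hg y).const_mul _)).trans ?_)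
      (integral_const_mul _ _)
    exact congrArg₂ _ (integral_const_mul _ _) (integral_const_mul _ _)
  rw [Eone, hint]
  simp only [fun ξ => (h ξ).2]
  ring

/-- Initial values for pairs of intervals, extended by zero. -/
def octantExt (F : ℝ → ℝ → ℝ → ℝ) (p : ℝ × ℝ × ℝ) : ℝ :=
  (Ioi (0 : ℝ) ×ˢ Ioi (0 : ℝ) ×ˢ Ioi (0 : ℝ)).indicator (fun p => F p.1 p.2.1 p.2.2) p

lemma strictMono_ends_iff (q : (ℤ × ℤ × ℤ) × ℤ) :
    StrictMono (ends q) ↔ 0 < q.1.1 ∧ 0 < q.1.2.1 ∧ 0 < q.1.2.2 := by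
  rw [Fin.strictMono_iff_lt_succ]
  constructor
  · intro h
    have h0 := h 0
    have h1 := h 1
    have h2 := h 2
    simp [ends] at h0 h1 h2
    exact ⟨h0, h2, h1⟩
  · rintro ⟨h0, h1, h2⟩ i
    fin_cases i <;> simp [ends, h0, h1, h2]

/-- Convergence of the initial two-interval profile. -/
lemma tendsto_indicator_floorCell {a : ℕ → ℝ} (ha : ∀ k, 0 < a k) (ha0 : Tendsto a atTop (𝓝 0))
    {f : ℕ → (Fin 4 → ℤ) → ℝ} {e : ℕ → ℕ → ℕ → ℕ → ℝ}
    (hf : ∀ k x, StrictMono x →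
      f k x = e k (x 1 - x 0).toNat (x 3 - x 2).toNat (x 2 - x 1).toNat)
    {F : ℝ → ℝ → ℝ → ℝ}
    (hF : ∀ x y z, 0 < x → 0 < y → 0 < z →
      Tendsto (fun k => e k ⌊x / a k⌋₊ ⌊y / a k⌋₊ ⌊z / a k⌋₊) atTop (𝓝 (F x y z)))
    (q : (ℝ × ℝ × ℝ) × ℝ) :
    Tendsto (fun k => {y | StrictMono y}.indicator (f k) (ends (floorCell (a k) q))) atTop
      (𝓝 (octantExt F q.1)) := by
  obtain ⟨⟨x, y, z⟩, u⟩ := q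
  by_cases hq : 0 < x ∧ 0 < y ∧ 0 < z
  · obtain ⟨hx, hy, hz⟩ := hq
    rw [octantExt, indicator_of_mem (by simp [hx, hy, hz])]
    refine (hF x y z hx hy hz).congr' ?_
    filter_upwards [eventually_floor_div_pos ha ha0 hx, eventually_floor_div_pos ha ha0 hy,
      eventually_floor_div_pos ha ha0 hz] with k kx ky kz
    have hmono : StrictMono (ends (floorCell (a k) ((x, y, z), u))) :=
      (strictMono_ends_iff _).2 ⟨kx, ky, kz⟩
    rw [indicator_of_mem (s := {y : Fin 4 → ℤ | StrictMono y}) hmono, hf k _ hmono]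
    simp [ends, floorCell, Int.floor_toNat]
  · rw [octantExt, indicator_of_notMem (by simpa using hq)]
    refine tendsto_const_nhds.congr fun k => ?_
    rw [indicator_of_notMem]
    intro hmono
    have h := (strictMono_ends_iff _).1 (show StrictMono _ from hmono)
    refine hq ⟨?_, ?_, ?_⟩
    · by_contra hc; exact floor_div_nonpos (ha k) hc h.1
    · by_contra hc; exact floor_div_nonpos (ha k) hc h.2.1
    · by_contra hc; exact floor_div_nonpos (ha k) hc h.2.2

/-- Fubini in the position `u`, on which the initial data do not depend. Absolute convergence comes
with it, so `K₂` itself needs no estimate. -/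
lemma integrableOn_EtwoIntegrand_and_Etwo_eq {κ : ℝ} (hκ : 0 < κ) {F : ℝ → ℝ → ℝ → ℝ}
    (hF : AEStronglyMeasurable fun q : (ℝ × ℝ × ℝ) × ℝ => octantExt F q.1)
    (hF1 : ∀ p, |octantExt F p| ≤ 1) (x y z : ℝ) :
    IntegrableOn (EtwoIntegrand F √(8 * κ) x y z)
      (Ioi (0 : ℝ) ×ˢ Ioi (0 : ℝ) ×ˢ Ioi (0 : ℝ)) ∧
    ∑ σ : Equiv.Perm (Fin 4), (Equiv.Perm.sign σ : ℝ) *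
      ∫ q : (ℝ × ℝ × ℝ) × ℝ, (∏ i, heatDensity κ (![0, x, x + z, x + z + y] (σ i) - ends q i)) *
        octantExt F q.1 = Etwo F √(8 * κ) x y z := by
  set ξ : Fin 4 → ℝ := ![0, x, x + z, x + z + y]
  set C : ℝ := √2 / (√(8 * κ) ^ 3 * √Real.pi ^ 3) with hC
  have hC0 : C ≠ 0 := by have := Real.pi_pos; positivity
  have hS : MeasurableSet (Ioi (0 : ℝ) ×ˢ Ioi (0 : ℝ) ×ˢ Ioi (0 : ℝ)) :=
    measurableSet_Ioi.prod (measurableSet_Ioi.prod measurableSet_Ioi)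
  have hint : ∀ σ : Equiv.Perm (Fin 4), Integrable fun q : (ℝ × ℝ × ℝ) × ℝ =>
      (∏ i, heatDensity κ (ξ (σ i) - ends q i)) * octantExt F q.1 := fun σ =>
    (integrable_prod_heatDensity hκ fun i => ξ (σ i)).mul_bdd hF
      (Eventually.of_forall fun q => hF1 q.1)
  have hsum : ∀ q : (ℝ × ℝ × ℝ) × ℝ, chamberDensity κ ξ q * octantExt F q.1 =
      ∑ σ : Equiv.Perm (Fin 4), (Equiv.Perm.sign σ : ℝ) *
        ((∏ i, heatDensity κ (ξ (σ i) - ends q i)) * octantExt F q.1) := by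
    intro q
    rw [chamberDensity, Finset.sum_mul]
    exact Finset.sum_congr rfl fun σ _ => mul_assoc _ _ _
  have hI : Integrable fun q : (ℝ × ℝ × ℝ) × ℝ => chamberDensity κ ξ q * octantExt F q.1 := by
    simp only [hsum]
    exact integrable_finsetSum _ fun σ _ => (hint σ).const_mul _
  have hinner : ∀ p, ∫ u, chamberDensity κ ξ (p, u) * octantExt F p = C *
      (Ioi (0 : ℝ) ×ˢ Ioi (0 : ℝ) ×ˢ Ioi (0 : ℝ)).indicator
        (EtwoIntegrand F √(8 * κ) x y z) p := by
    intro p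
    rw [integral_mul_const, integral_chamberDensity hκ x y z p, octantExt, ← hC]
    by_cases hp : p ∈ Ioi (0 : ℝ) ×ˢ Ioi (0 : ℝ) ×ˢ Ioi (0 : ℝ)
    · rw [indicator_of_mem hp, indicator_of_mem hp, EtwoIntegrand]
      ring
    · rw [indicator_of_notMem hp, indicator_of_notMem hp]
      ring
  rw [Measure.volume_eq_prod] at hI
  constructor
  · rw [← integrable_indicator_iff hS]
    refine (hI.integral_prod_left.const_mul C⁻¹).congr (Eventually.of_forall fun p => ?_)
    simp only [hinner]
    rw [inv_mul_cancel_left₀ hC0]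
  · simp only [← integral_const_mul]
    rw [← integral_finsetSum _ fun σ _ => (hint σ).const_mul _]
    simp only [← hsum]
    rw [Measure.volume_eq_prod, integral_prod _ hI]
    simp only [hinner]
    rw [integral_const_mul, integral_indicator hS, Etwo]

/-! ### Assembly of the continuum limit -/

lemma tendsto_mul_natFloor_div {a : ℕ → ℝ} (ha : ∀ k, 0 < a k) (ha0 : Tendsto a atTop (𝓝 0))
    {v : ℝ} (hv : 0 ≤ v) : Tendsto (fun k => a k * (⌊v / a k⌋₊ : ℝ)) atTop (𝓝 v) := by
  refine (tendsto_mul_floor_div ha ha0 v).congr fun k => ?_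
  rw [← natCast_floor_eq_intCast_floor (div_nonneg hv (ha k).le)]

lemma emptyProb_mem_Icc (ν : Measure Config) [IsProbabilityMeasure ν] (S : Finset ℤ) :
    0 ≤ emptyProb ν S ∧ emptyProb ν S ≤ 1 :=
  ⟨measureReal_nonneg, measureReal_le_one⟩

/-- The continuum limit of the two-interval probabilities. -/
lemma tendsto_twoInterval {D : ℝ} (hD : 0 < D) {a : ℕ → ℝ} (ha : ∀ k, 0 < a k)
    (ha0 : Tendsto a atTop (𝓝 0)) {μ : ℕ → ℝ → Measure Config}
    (hμ : ∀ k, IsLaw (D / a k ^ 2) (μ k)) (hinv : ∀ k, IsTranslationInvariant (μ k 0))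
    {E₀ : ℝ → ℝ} {F₀ : ℝ → ℝ → ℝ → ℝ}
    (hE : ∀ x, 0 < x → Tendsto (fun k => oneInterval (μ k 0) ⌊x / a k⌋₊) atTop (𝓝 (E₀ x)))
    (hF : ∀ x y z, 0 < x → 0 < y → 0 < z →
      Tendsto (fun k => twoInterval (μ k 0) ⌊x / a k⌋₊ ⌊y / a k⌋₊ ⌊z / a k⌋₊) atTop
        (𝓝 (F₀ x y z)))
    {t x y z : ℝ} (ht : 0 < t) (hx : 0 ≤ x) (hy : 0 ≤ y) (hz : 0 ≤ z) :
    IntegrableOn (EoneIntegrand E₀ (diffLength D t) x y z) (Ioi 0) ∧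
    IntegrableOn (EtwoIntegrand F₀ (diffLength D t) x y z)
      (Ioi (0 : ℝ) ×ˢ Ioi (0 : ℝ) ×ˢ Ioi (0 : ℝ)) ∧
    Tendsto (fun k => twoInterval (μ k t) ⌊x / a k⌋₊ ⌊y / a k⌋₊ ⌊z / a k⌋₊) atTop
      (𝓝 (Ezero (diffLength D t) x y z + Eone E₀ (diffLength D t) x y z
        + Etwo F₀ (diffLength D t) x y z)) := by
  have hprob : ∀ k, IsProbabilityMeasure (μ k 0) := fun k =>
    (hμ k).isProbabilityMeasure 0 le_rfl
  have hκ : 0 < D * t := by positivity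
  have hκ' : 0 < 2 * (D * t) := by positivity
  have hΓ : ∀ k, 0 ≤ D / a k ^ 2 := fun k => by have := ha k; positivity
  have hΓ' : ∀ k, 0 ≤ 2 * (D / a k ^ 2) := fun k => by have := ha k; positivity
  have hone0 : ∀ k n, 0 ≤ oneInterval (μ k 0) n := fun k n => (emptyProb_mem_Icc _ _).1
  have hone1 : ∀ k n, oneInterval (μ k 0) n ≤ 1 := fun k n => (emptyProb_mem_Icc _ _).2
  have htwo0 : ∀ k x, 0 ≤ emptyProb (μ k 0) (blocks x) := fun k x => (emptyProb_mem_Icc _ _).1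
  have htwo1 : ∀ k x, emptyProb (μ k 0) (blocks x) ≤ 1 := fun k x => (emptyProb_mem_Icc _ _).2
  choose A hA hAb hA0 hAi hArep using fun k => exists_odd_isHeatSol (hΓ' k)
    (f := fun _ => 1) (fun _ => zero_le_one) (fun _ => le_rfl)
  choose H hH hHb hH0 hHi hHrep using fun k => exists_odd_isHeatSol (hΓ' k)
    (f := fun n => oneInterval (μ k 0) n.toNat) (fun n => hone0 k _) (fun n => hone1 k _)
  choose V hV hVb hV0 hVi hVrep using fun k => exists_alternating_isHeatSol (hΓ k)
    (f := fun x => emptyProb (μ k 0) (blocks x)) (htwo0 k) (htwo1 k)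
  -- One minus the odd solution with data 1 has boundary value 1 and vanishes initially at positive
  -- lengths.
  set P : ℕ → ℤ → ℝ → ℝ := fun k n s => 1 - A k n s with hPdef
  have hP : ∀ k, IsHeatSol (2 * (D / a k ^ 2)) stepInt (P k) := fun k =>
    (isHeatSol_const 1).sub (hA k)
  have hPb : ∀ k, LocBdd (P k) := fun k =>
    (LocBdd.of_le (u := fun _ _ => (1 : ℝ)) fun _ _ _ => le_rfl).sub (hAb k)
  have hP0 : ∀ k s, P k 0 s = 1 := fun k s => by simp [hPdef, hA0]
  have hPi : ∀ k n, 0 < n → P k n 0 = 0 := fun k n hn => by simp [hPdef, hAi k n hn]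
  have hblock : ∀ k (x : Fin 2 → ℤ) s, x 0 ≤ x 1 → 0 ≤ s →
      emptyProb (μ k s) (block x) = P k (x 1 - x 0) s + H k (x 1 - x 0) s := fun k x s hx hs =>
    (hμ k).emptyProb_block (hΓ k) (e := fun n s => P k n s + H k n s) ((hP k).add (hH k))
      ((hPb k).add (hHb k)) (fun s => by simp [hP0, hH0]) (fun x hx => by
        rw [(hinv k).emptyProb_block hx.le, hPi k _ (sub_pos.2 hx), hHi k _ (sub_pos.2 hx),
          zero_add]) hx hs
  set X : ℕ → Fin 4 → ℤ := fun k => ![0, (⌊x / a k⌋₊ : ℤ), (⌊x / a k⌋₊ : ℤ) + ⌊z / a k⌋₊,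
    (⌊x / a k⌋₊ : ℤ) + ⌊z / a k⌋₊ + ⌊y / a k⌋₊] with hXdef
  have hsol : ∀ k, twoInterval (μ k t) ⌊x / a k⌋₊ ⌊y / a k⌋₊ ⌊z / a k⌋₊ =
      pfaff (P k) (P k) (X k) t + pfaff (P k) (H k) (X k) t + pfaff (H k) (P k) (X k) t +
        V k (X k) t := fun k => by
    rw [twoInterval_eq_emptyProb_blocks]
    exact (hμ k).emptyProb_blocks (hΓ k) (hP k) (hPb k) (hP0 k) (hPi k) (hH k) (hHb k) (hH0 k)
      (hblock k) (hV k) (hVb k) (hV0 k) (hVi k) (by simp) (by simp) (by simp) ht.le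
  set ξ : Fin 4 → ℝ := ![0, x, x + z, x + z + y] with hξdef
  have hX : ∀ i, Tendsto (fun k => a k * (X k i : ℝ)) atTop (𝓝 (ξ i)) := by
    have lx := tendsto_mul_natFloor_div ha ha0 hx
    have ly := tendsto_mul_natFloor_div ha ha0 hy
    have lz := tendsto_mul_natFloor_div ha ha0 hz
    intro i
    fin_cases i
    · simp [X, ξ]
    · simpa [X, ξ] using lx
    · simpa [X, ξ, mul_add] using lx.add lz
    · simpa [X, ξ, mul_add] using (lx.add lz).add ly
  have hXd : ∀ i j, Tendsto (fun k => a k * ((X k j - X k i : ℤ) : ℝ)) atTop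
      (𝓝 (ξ j - ξ i)) := by
    intro i j
    push_cast
    simp only [mul_sub]
    exact (hX j).sub (hX i)
  have hl : diffLength D t = √(4 * (2 * (D * t))) := diffLength_eq D t
  have hl' : diffLength D t = √(8 * (D * t)) := by rw [diffLength, mul_assoc]
  -- Interval lengths diffuse at twice the rate of single endpoints, which is why `ℓ₀²` is both `4 *
  -- (2 D t)` and `8 * (D t)`.
  have hτ : ∀ k, 2 * (D / a k ^ 2) * t = 2 * (D * t) / a k ^ 2 := fun k => by ring
  have hτ' : ∀ k, D / a k ^ 2 * t = D * t / a k ^ 2 := fun k => by ring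
  have limP : ∀ i j, Tendsto (fun k => P k (X k j - X k i) t) atTop
      (𝓝 (erfc ((ξ j - ξ i) / diffLength D t))) := by
    intro i j
    have h := tendsto_odd_solution hκ' ha ha0 (e := fun _ _ => 1) (fun _ _ => zero_le_one)
      (fun _ _ => le_rfl) (E := fun _ => 1) (fun _ _ => tendsto_const_nhds) (hXd i j)
    rw [oddConv_one hκ', ← hl] at h
    simpa only [hPdef, hArep _ _ _ ht.le, hτ, sub_sub_cancel] using h.const_sub 1
  have limH : ∀ i j, Tendsto (fun k => H k (X k j - X k i) t) atTop
      (𝓝 (oddConv (2 * (D * t)) E₀ (ξ j - ξ i))) := by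
    intro i j
    have h := tendsto_odd_solution hκ' ha ha0 hone0 hone1 hE (hXd i j)
    simpa only [hHrep _ _ _ ht.le, hτ] using h
  have hflo := tendsto_indicator_floorCell ha ha0 (f := fun k x => emptyProb (μ k 0) (blocks x))
    (e := fun k => twoInterval (μ k 0)) (fun k x hx => (hinv k).emptyProb_blocks
      (hx (by decide : (0 : Fin 4) < 1)).le (hx (by decide : (1 : Fin 4) < 2)).le
      (hx (by decide : (2 : Fin 4) < 3)).le) hF
  have hind0 : ∀ k (n : (ℤ × ℤ × ℤ) × ℤ),
      0 ≤ {y | StrictMono y}.indicator (fun x => emptyProb (μ k 0) (blocks x)) (ends n) :=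
    fun k n => indicator_nonneg (fun _ _ => htwo0 k _) _
  have hind1 : ∀ k (n : (ℤ × ℤ × ℤ) × ℤ),
      {y | StrictMono y}.indicator (fun x => emptyProb (μ k 0) (blocks x)) (ends n) ≤ 1 :=
    fun k n => indicator_le' (fun _ _ => htwo1 k _) (fun _ _ => zero_le_one) _
  -- Measurability of the initial profile is inherited from the lattice step functions that converge
  -- to it.
  have hFmeas : AEStronglyMeasurable fun q : (ℝ × ℝ × ℝ) × ℝ => octantExt F₀ q.1 :=
    aestronglyMeasurable_of_tendsto_ae atTop (fun k => (Measurable.comp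
      (g := fun n => {y | StrictMono y}.indicator (fun x => emptyProb (μ k 0) (blocks x)) (ends n))
      Measurable.of_discrete (measurable_floorCell (a k))).aestronglyMeasurable)
      (Eventually.of_forall hflo)
  have hFbd : ∀ p, |octantExt F₀ p| ≤ 1 := fun p => by
    have h := hflo (p, 0)
    rw [abs_of_nonneg (ge_of_tendsto' h fun k => hind0 k _)]
    exact le_of_tendsto' h fun k => hind1 k _
  have limV : Tendsto (fun k => V k (X k) t) atTop (𝓝 (Etwo F₀ (diffLength D t) x y z)) := by
    rw [hl', ← (integrableOn_EtwoIntegrand_and_Etwo_eq hκ hFmeas hFbd x y z).2]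
    simp only [hVrep _ _ _ ht.le, hτ']
    exact tendsto_finsetSum _ fun σ _ => (tendsto_tsum_prod_walkKernel hκ ha ha0
      (fun i => hX (σ i)) hind0 hind1 (Eventually.of_forall hflo)).const_mul _
  have hEmeas : AEStronglyMeasurable ((Ioi (0 : ℝ)).indicator E₀) :=
    aestronglyMeasurable_of_tendsto_ae atTop (fun k => (Measurable.comp
      (g := posPart fun n => oneInterval (μ k 0) n.toNat) Measurable.of_discrete
      (measurable_id.div_const (a k)).floor).aestronglyMeasurable)
      (Eventually.of_forall (tendsto_posPart_floor ha ha0 hE))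
  have hEbd : ∀ v, 0 < v → |E₀ v| ≤ 1 := fun v hv => by
    rw [abs_of_nonneg (ge_of_tendsto' (hE v hv) fun k => hone0 k _)]
    exact le_of_tendsto' (hE v hv) fun k => hone1 k _
  have hEone := integrableOn_EoneIntegrand_and_Eone_eq hκ' hEmeas hEbd x y z
  rw [← hl] at hEone
  refine ⟨hEone.1, hl' ▸ (integrableOn_EtwoIntegrand_and_Etwo_eq hκ hFmeas hFbd x y z).1, ?_⟩
  have lim := fun {p q : ℕ → ℤ → ℝ → ℝ} {p' q' : Fin 4 → Fin 4 → ℝ}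
    (hp : ∀ i j, Tendsto (fun k => p k (X k j - X k i) t) atTop (𝓝 (p' i j)))
    (hq : ∀ i j, Tendsto (fun k => q k (X k j - X k i) t) atTop (𝓝 (q' i j))) =>
    (((hp 0 1).mul (hq 2 3)).sub ((hp 0 2).mul (hq 1 3))).add ((hp 0 3).mul (hq 1 2))
  have htot := (((lim limP limP).add (lim limP limH)).add (lim limH limP)).add limV
  simp only [hsol, pfaff]
  convert htot using 2
  rw [hEone.2, Ezero]
  have e01 : ξ 1 - ξ 0 = x := by simp [ξ]
  have e23 : ξ 3 - ξ 2 = y := by simp [ξ]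
  have e12 : ξ 2 - ξ 1 = z := by simp [ξ]
  have e02 : ξ 2 - ξ 0 = x + z := by simp [ξ]
  have e13 : ξ 3 - ξ 1 = y + z := by simp [ξ]; ring
  have e03 : ξ 3 - ξ 0 = x + y + z := by simp [ξ]; ring
  rw [e01, e23, e12, e02, e13, e03]
  ring

/-! ### The completely filled initial state -/

lemma twoInterval_dirac_of_pos {n₁ : ℕ} (hn : 0 < n₁) (n₂ d : ℕ) :
    twoInterval (Measure.dirac fun _ => true) n₁ n₂ d = 0 := by
  rw [twoInterval, emptyProb, measureReal_def,
    Measure.dirac_apply' _ (measurableSet_empty _), indicator_of_notMem, ENNReal.toReal_zero]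
  intro h
  have := h 0 (by simp [hn])
  simp at this

lemma oneInterval_dirac_of_pos {n : ℕ} (hn : 0 < n) :
    oneInterval (Measure.dirac fun _ => true) n = 0 := by
  rw [oneInterval, emptyProb, measureReal_def,
    Measure.dirac_apply' _ (measurableSet_empty _), indicator_of_notMem, ENNReal.toReal_zero]
  intro h
  have := h 0 (by simp [hn])
  simp at this

lemma eventually_natFloor_div_pos {a : ℕ → ℝ} (ha : ∀ k, 0 < a k) (ha0 : Tendsto a atTop (𝓝 0))
    {v : ℝ} (hv : 0 < v) : ∀ᶠ k in atTop, 0 < ⌊v / a k⌋₊ := by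
  filter_upwards [(tendsto_div_atTop_of_pos ha ha0 hv).eventually_ge_atTop 1] with k hk
  exact Nat.floor_pos.2 hk

end CoagulationDiffusion

end

open CoagulationDiffusion in
/-- Continuum limit of the two-interval empty probability of the coagulation-diffusion process:
`a k → 0` are lattice constants, `μ k t` is the law at time `t` of the process on the chain with
lattice constant `a k` and hopping rate `D / (a k) ^ 2`. -/
theorem mainTheorem1 (D : ℝ) (hD : 0 < D) (a : ℕ → ℝ) (ha : ∀ k, 0 < a k)
    (ha0 : Tendsto a atTop (𝓝 0)) (μ : ℕ → ℝ → Measure Config)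
    (hμ : ∀ k, IsLaw (D / a k ^ 2) (μ k)) (hinv : ∀ k, IsTranslationInvariant (μ k 0)) :
    (∀ (E₀ : ℝ → ℝ) (F₀ : ℝ → ℝ → ℝ → ℝ),
      (∀ x, 0 < x →
        Tendsto (fun k => oneInterval (μ k 0) ⌊x / a k⌋₊) atTop (𝓝 (E₀ x))) →
      (∀ x y z, 0 < x → 0 < y → 0 < z →
        Tendsto (fun k => twoInterval (μ k 0) ⌊x / a k⌋₊ ⌊y / a k⌋₊ ⌊z / a k⌋₊) atTop
          (𝓝 (F₀ x y z))) →
      ∀ t x y z, 0 < t → 0 ≤ x → 0 ≤ y → 0 ≤ z →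
        IntegrableOn (EoneIntegrand E₀ (diffLength D t) x y z) (Ioi 0) ∧
        IntegrableOn (EtwoIntegrand F₀ (diffLength D t) x y z)
          (Ioi (0 : ℝ) ×ˢ Ioi (0 : ℝ) ×ˢ Ioi (0 : ℝ)) ∧
        Tendsto (fun k => twoInterval (μ k t) ⌊x / a k⌋₊ ⌊y / a k⌋₊ ⌊z / a k⌋₊) atTop
          (𝓝 (Ezero (diffLength D t) x y z + Eone E₀ (diffLength D t) x y z
            + Etwo F₀ (diffLength D t) x y z))) ∧
    ((∀ k, μ k 0 = Measure.dirac (fun _ => true)) →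
      ∀ t x y z, 0 < t → 0 ≤ x → 0 ≤ y → 0 ≤ z →
        Tendsto (fun k => twoInterval (μ k t) ⌊x / a k⌋₊ ⌊y / a k⌋₊ ⌊z / a k⌋₊) atTop
          (𝓝 (Ezero (diffLength D t) x y z))) := by
  refine ⟨fun E₀ F₀ hE hF t x y z ht hx hy hz =>
    tendsto_twoInterval hD ha ha0 hμ hinv hE hF ht hx hy hz, fun hfull t x y z ht hx hy hz => ?_⟩
  -- On a full lattice both limit profiles are zero, because an interval of positive length
  -- eventually contains a site; `E⁽¹⁾` and `E⁽²⁾` then vanish.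
  have h := (tendsto_twoInterval hD ha ha0 hμ hinv (E₀ := fun _ => 0) (F₀ := fun _ _ _ => 0)
    (fun x hx => ?_) (fun x y z hx _ _ => ?_) ht hx hy hz).2.2
  · simpa [Eone, Etwo, EoneIntegrand, EtwoIntegrand] using h
  · refine tendsto_const_nhds.congr' ?_
    filter_upwards [eventually_natFloor_div_pos ha ha0 hx] with k hk
    rw [hfull, oneInterval_dirac_of_pos hk]
  · refine tendsto_const_nhds.congr' ?_
    filter_upwards [eventually_natFloor_div_pos ha ha0 hx] with k hk
    rw [hfull, twoInterval_dirac_of_pos hk]
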